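/- A directed graph $G=(V,E)$ on the vertex set $V=\{0,\dots,n-1\}$, $n\ge 1$, is given in the array model: the out-degrees $d_0,\dots,d_{n-1}$ are known, and the edges are given by arrays $f_i:\{0,\dots,d_i-1\}\to V$, each injective, where $f_i(j)$ is the $j$-th out-neighbour of $i$; a query returns an entry $f_i(j)$. Put $m=\sum_i d_i=|E|$. The number of queries of a quantum query algorithm is counted in the worst case, and a graph is strongly connected if every vertex can be reached from every vertex by a directed path. There is a constant $C>0$ such that for all $n$, all $(d_i)$ and every vertex $v_0$ there is a quantum algorithm that makes at most $C\sqrt{nm\log n}$ queries to the arrays and, on every such graph $G$ with out-degrees $(d_i)$, outputs an edge set $E'=A\cup B$ with the following properties. 1. With certainty, $E'\subseteq E$; $A$ is the edge set of a directed tree rooted at $v_0$ (edges directed away from $v_0$; possibly the one-vertex tree); $B$ contains at most one edge out of each vertex; and $E'$ covers $v_0$, that is, $E'$ contains an edge out of $v_0$ if $d_{v_0}>0$. 2. With probability at least $\frac14$, $A$ is a depth-first search tree of $G$ from $v_0$ (containing all vertices reachable from $v_0$), and, with the vertices of this tree numbered in the order in which the search discovers them, $B$ consists of the edges from each vertex of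 the tree that has an out-neighbour to its out-neighbour with smallest number. 3. If $G$ is strongly connected, then with probability at least $\frac14$ the property in 2 holds and $(V,E')$ is strongly connected. Consequently, there is a constant $C'>0$ such that for all $n\ge1$ and all $(d_i)$, some quantum algorithm that makes at most $C'\sqrt{nm\log n}$ queries decides, with probability at least $\frac23$ of being correct on each input, whether $G$ is strongly connected. -/

import Mathlib

/-! ### Directed graphs in the adjacency array model -/

/-- An input of the array model on the vertex set `Fin n` with out-degrees `d`: for each vertex `i`,
the array `f i`, whose entry `f i j` is the `j`-th out-neighbour of `i`. -/
abbrev ArrayGraph (n : ℕ) (d : Fin n → ℕ) : Type := (i : Fin n) → Fin (d i) → Fin n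

namespace ArrayGraph

variable {n : ℕ} {d : Fin n → ℕ}

/-- The simple graph promise: no array lists the same neighbour twice. -/
def IsSimple (f : ArrayGraph n d) : Prop := ∀ i, Function.Injective (f i)

/-- The edge relation of the encoded directed graph. -/
def Edge (f : ArrayGraph n d) (u v : Fin n) : Prop := ∃ j, f u j = v

/-- The input as a black box: the position `(i, j)` is answered by `f i j`. -/
def entry (f : ArrayGraph n d) (q : (i : Fin n) × Fin (d i)) : Fin n := f q.1 q.2

end ArrayGraph

/-- Any vertex can be reached from any vertex by a directed path. -/
def StronglyConnected {V : Type} (E : V → V → Prop) : Prop :=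
  ∀ u v, Relation.ReflTransGen E u v

/-- The relation given by a finite set of directed edges. -/
def edgeRel {V : Type} (A : Finset (V × V)) (u v : V) : Prop := (u, v) ∈ A

/-- `A` is the edge set of a directed tree rooted at `r`, with all edges pointing away from `r`
(the one-vertex tree has `A = ∅`). -/
def IsTreeRootedAt {V : Type} (r : V) (A : Finset (V × V)) : Prop :=
  (∀ e ∈ A, e.2 ≠ r) ∧
  (∀ e ∈ A, ∀ e' ∈ A, e.2 = e'.2 → e = e') ∧
  (∀ e ∈ A, Relation.ReflTransGen (edgeRel A) r e.1)

/-- One step of depth-first search. A state consists of the stack (its top first), the list of the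
vertices visited so far in the order of their discovery, and the set of tree edges. -/
inductive DfsStep {V : Type} [DecidableEq V] (E : V → V → Prop) :
    List V × List V × Finset (V × V) → List V × List V × Finset (V × V) → Prop
  | push (u v : V) (T S : List V) (A : Finset (V × V)) (huv : E u v) (hv : v ∉ S) :
      DfsStep E (u :: T, S, A) (v :: u :: T, S ++ [v], insert (u, v) A)
  | pop (u : V) (T S : List V) (A : Finset (V × V)) (hu : ∀ v, E u v → v ∈ S) :
      DfsStep E (u :: T, S, A) (T, S, A)

/-- Some complete depth-first search from `v₀` discovers the vertices in the order `S` and has the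
tree edges `A`. -/
def IsDepthFirst {V : Type} [DecidableEq V] (E : V → V → Prop) (v₀ : V) (S : List V)
    (A : Finset (V × V)) : Prop :=
  Relation.ReflTransGen (DfsStep E) ([v₀], [v₀], ∅) ([], S, A)

/-- `B` consists, for every vertex `u` of the list `S` that has an out-neighbour, of the edge from
`u` to its out-neighbour of smallest index in `S`. -/
def IsSmallestNeighbourSet {V : Type} [DecidableEq V] (E : V → V → Prop) (S : List V)
    (B : Finset (V × V)) : Prop :=
  ∀ u w, (u, w) ∈ B ↔ u ∈ S ∧ E u w ∧ ∀ x, E u x → S.idxOf w ≤ S.idxOf x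

/-- `A` is a depth-first tree from `v₀`, and `B` consists of the edges from the vertices of that
tree to their out-neighbours of smallest index, in the order in which the search discovers them. -/
def IsDfsWithSmallestNeighbours {V : Type} [DecidableEq V] (E : V → V → Prop) (v₀ : V)
    (A B : Finset (V × V)) : Prop :=
  ∃ S : List V, IsDepthFirst E v₀ S A ∧ IsSmallestNeighbourSet E S B

/-! ### Quantum query algorithms -/

/-- A quantum algorithm that queries a black box `x : Q → Fin n`. Its basis states are triples
`(q, b, w)` of a query register (`none` means: no query), an answer register and a workspace.
It starts in a basis state, applies unitaries that do not depend on `x`, with a query between any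
two consecutive ones, and finally measures in the computational basis; the measured basis state
determines the output. -/
structure QuantumQueryAlgorithm (Q : Type) [Fintype Q] [DecidableEq Q] (n : ℕ) (Out : Type) where
  /-- the basis of the workspace -/
  Work : Type
  fintypeWork : Fintype Work
  decidableEqWork : DecidableEq Work
  /-- the number of queries -/
  queries : ℕ
  /-- the initial basis state -/
  start : Option Q × Fin n × Work
  /-- the unitary applied after the `t`-th query (before the first one for `t = 0`) -/
  unitary : ℕ → Matrix.unitaryGroup (Option Q × Fin n × Work) ℂ
  /-- the output for each measured basis state -/
  output : Option Q × Fin n × Work → Out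

namespace QuantumQueryAlgorithm

attribute [instance] QuantumQueryAlgorithm.fintypeWork QuantumQueryAlgorithm.decidableEqWork

variable {Q : Type} [Fintype Q] [DecidableEq Q] {n : ℕ} {Out : Type}

/-- A query: `|q, b, w⟩ ↦ |q, b + x q mod n, w⟩` and `|none, b, w⟩ ↦ |none, b, w⟩`, extended
linearly to the vectors `ψ` of amplitudes. -/
def query [NeZero n] {W : Type} (x : Q → Fin n) (ψ : Option Q × Fin n × W → ℂ) :
    Option Q × Fin n × W → ℂ
  | (none, b, w) => ψ (none, b, w)
  | (some q, b, w) => ψ (some q, b - x q, w)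

/-- The state after `t` queries and the unitary that follows them. -/
noncomputable def state [NeZero n] (M : QuantumQueryAlgorithm Q n Out) (x : Q → Fin n) :
    ℕ → (Option Q × Fin n × M.Work → ℂ)
  | 0 => (M.unitary 0).1.mulVec (Pi.single M.start 1)
  | t + 1 => (M.unitary (t + 1)).1.mulVec (query x (M.state x t))

open Classical in
/-- The probability that the output of `M` on the black box `x` satisfies `P`. -/
noncomputable def prob [NeZero n] (M : QuantumQueryAlgorithm Q n Out) (x : Q → Fin n)
    (P : Out → Prop) : ℝ :=
  ∑ s, if P (M.output s) then ‖M.state x M.queries s‖ ^ 2 else 0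

end QuantumQueryAlgorithm

/-- Quantum query algorithms for the array model on `n` vertices with out-degrees `d`; the degrees
are known to the algorithm and only accesses to the arrays are counted. -/
abbrev ArrayAlgorithm (n : ℕ) (d : Fin n → ℕ) (Out : Type) : Type 1 :=
  QuantumQueryAlgorithm ((i : Fin n) × Fin (d i)) n Out

set_option linter.unusedSectionVars false

/-! The algorithm is the quantum form of a classical procedure that usually guesses the answers to
its queries. A depth-first search guesses that each scanned vertex has been visited; then a scan of
all positions in an order `σ` guesses that the entry does not improve on the best out-neighbour
known so far. There are at most `2m` queries. In the search a guess fails only when a vertex is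
discovered, fewer than `n` times. In the scan it fails only at a record, and for uniformly random
`σ` the out-neighbour of rank `r` of a vertex is a record with probability `1/r`. Simplicity makes
the ranks distinct and the out-degrees at most `n`, so at most `n(1 + log n)` records are expected.

Such a procedure with `T` queries and `I` wrong guesses costs `O(√(TI))` quantum queries
(`GuessingMachine.exists_algorithm`). A query separates two inputs at a node only if it leads to
different surprises; with a weight `a`, a right guess costs `2a` and a wrong one `2/a - 1`, and `a`
balances the two totals. The vectors of all nodes form a catalyst: with it, one query and a unitary
turn a fixed state into the output state and give the catalyst back (`exists_of_catalyst`). Spread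
over `K` queries, the catalyst has square norm proportional to `1/K` and may be left out at the
start. The unitaries are never written down; equality of Gram matrices provides them. The average
over `σ` is taken in superposition, so only the expected cost matters.

The search outputs positions. Querying the at most `2n` claimed positions, together with one edge
out of `v₀` as a fallback, yields the properties that hold with certainty (`exists_postprocessing`,
`exists_certified_algorithm`).

If `G` is strongly connected, let `z` be the vertex of smallest number reachable in `A ∪ B` from a
given vertex. An edge of `G` leaving the set of descendants of `z` would lead to a number below that
of `z`, and the edge of `B` from the same vertex would lead at least as low, against minimality. So
the descendants of `z` are all vertices, and `z` reaches `v₀` in the tree. -/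

/-! ### Unitaries and algorithms from Gram matrices -/

/-- The Euclidean square norm of a vector of amplitudes. -/
noncomputable def normSq {ι : Type} [Fintype ι] (ψ : ι → ℂ) : ℝ := ∑ s, ‖ψ s‖ ^ 2

theorem star_dotProduct_self_eq_normSq {ι : Type} [Fintype ι] (ψ : ι → ℂ) :
    star ψ ⬝ᵥ ψ = (normSq ψ : ℂ) := by
  simp only [dotProduct, normSq, Pi.star_apply, Complex.ofReal_sum]
  refine Finset.sum_congr rfl fun s _ => ?_
  rw [RCLike.star_def, Complex.conj_mul']
  push_cast; rfl

/-- The Gram matrix determines the norms of all linear combinations, so `a x ↦ b x` extends to a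
linear isometry of the spans, and in finite dimension this extends to a unitary. -/
theorem exists_unitary_of_gram {ι X : Type} [Fintype ι] [DecidableEq ι] (a b : X → ι → ℂ)
    (h : ∀ x y, star (a x) ⬝ᵥ a y = star (b x) ⬝ᵥ b y) :
    ∃ U : Matrix.unitaryGroup ι ℂ, ∀ x, U.1.mulVec (a x) = b x := by
  classical
  let a' : X → EuclideanSpace ℂ ι := fun x => WithLp.toLp 2 (a x)
  let b' : X → EuclideanSpace ℂ ι := fun x => WithLp.toLp 2 (b x)
  have hin : ∀ x y, inner ℂ (a' x) (a' y) = inner ℂ (b' x) (b' y) := fun x y => by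
    simp only [EuclideanSpace.inner_eq_star_dotProduct, a', b']
    rw [dotProduct_comm, h, dotProduct_comm]
  let A := Finsupp.linearCombination ℂ a'
  let B := Finsupp.linearCombination ℂ b'
  have hAB : ∀ c, ‖A c‖ = ‖B c‖ := fun c => by
    have : inner ℂ (A c) (A c) = inner ℂ (B c) (B c) := by
      simp only [A, B, Finsupp.linearCombination_apply, Finsupp.sum, sum_inner, inner_sum,
        inner_smul_left, inner_smul_right, hin]
    rw [← sq_eq_sq₀ (norm_nonneg _) (norm_nonneg _), ← inner_self_eq_norm_sq (𝕜 := ℂ),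
      ← inner_self_eq_norm_sq (𝕜 := ℂ), this]
  obtain ⟨g, hg⟩ := LinearMap.exists_rightInverse_of_surjective A.rangeRestrict
    A.range_rangeRestrict
  have hg' : ∀ y, A (g y) = y := fun y => by
    have := LinearMap.congr_fun hg y
    exact congrArg Subtype.val this
  let T : LinearMap.range A →ₗᵢ[ℂ] EuclideanSpace ℂ ι :=
    { toLinearMap := B ∘ₗ g
      norm_map' := fun y => by
        rw [LinearMap.comp_apply, ← hAB, hg']; rfl }
  have hT : ∀ c, T.extend (A c) = B c := fun c => by
    have h1 := T.extend_apply ⟨A c, LinearMap.mem_range_self A c⟩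
    rw [h1]
    change B (g _) = B c
    -- `g (A c)` and `c` differ by an element of the kernel of `A`, which `B` also kills because the
    -- norms agree.
    rw [← sub_eq_zero, ← map_sub, ← norm_eq_zero, ← hAB, map_sub, hg', sub_self, norm_zero]
  let U := (Matrix.toEuclideanCLM (n := ι) (𝕜 := ℂ)).symm T.extend.toContinuousLinearMap
  have hU : Matrix.toEuclideanCLM (n := ι) (𝕜 := ℂ) U = T.extend.toContinuousLinearMap :=
    StarAlgEquiv.apply_symm_apply _ _
  refine ⟨⟨U, ?_⟩, fun x => ?_⟩
  · rw [Matrix.mem_unitaryGroup_iff']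
    apply EquivLike.injective (Matrix.toEuclideanCLM (n := ι) (𝕜 := ℂ))
    rw [map_mul, map_star, map_one, hU]
    exact (ContinuousLinearMap.norm_map_iff_adjoint_comp_self _).1 T.extend.norm_map
  · have h1 := hT (Finsupp.single x 1)
    simp only [A, B, Finsupp.linearCombination_single, one_smul] at h1
    have h2 : Matrix.toEuclideanCLM (n := ι) (𝕜 := ℂ) U (a' x) = b' x := by
      rw [hU]; exact h1
    have h3 := congrArg WithLp.ofLp h2
    rw [Matrix.ofLp_toEuclideanCLM] at h3
    exact h3

theorem star_unitary_mulVec_dotProduct {ι : Type} [Fintype ι] [DecidableEq ι]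
    (U : Matrix.unitaryGroup ι ℂ) (φ ψ : ι → ℂ) :
    star (U.1.mulVec φ) ⬝ᵥ U.1.mulVec ψ = star φ ⬝ᵥ ψ := by
  rw [Matrix.star_mulVec, ← Matrix.dotProduct_mulVec, Matrix.mulVec_mulVec,
    ← Matrix.star_eq_conjTranspose, Matrix.mem_unitaryGroup_iff'.1 U.2, Matrix.one_mulVec]

theorem normSq_unitary_mulVec {ι : Type} [Fintype ι] [DecidableEq ι]
    (U : Matrix.unitaryGroup ι ℂ) (ψ : ι → ℂ) : normSq (U.1.mulVec ψ) = normSq ψ := by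
  have h := star_unitary_mulVec_dotProduct U ψ ψ
  rw [star_dotProduct_self_eq_normSq, star_dotProduct_self_eq_normSq] at h
  exact_mod_cast h

namespace QuantumQueryAlgorithm

variable {Q : Type} [Fintype Q] [DecidableEq Q] {n : ℕ} [NeZero n] {Out : Type}

theorem query_sub {W : Type} (x : Q → Fin n) (φ ψ : Option Q × Fin n × W → ℂ) :
    query x (φ - ψ) = query x φ - query x ψ := by
  funext ⟨q, b, w⟩
  cases q <;> rfl

theorem normSq_query {W : Type} [Fintype W] (x : Q → Fin n) (ψ : Option Q × Fin n × W → ℂ) :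
    normSq (query x ψ) = normSq ψ := by
  simp only [normSq, Fintype.sum_prod_type, Fintype.sum_option, query]
  congr 1
  exact Finset.sum_congr rfl fun q _ =>
    Equiv.sum_comp (Equiv.subRight (x q)) fun b => ∑ w, ‖ψ (some q, b, w)‖ ^ 2

theorem normSq_state (M : QuantumQueryAlgorithm Q n Out) (x : Q → Fin n) (t : ℕ) :
    normSq (M.state x t) = 1 := by
  induction t with
  | zero =>
    rw [state, normSq_unitary_mulVec, normSq, Finset.sum_eq_single M.start] <;>
      simp +contextual
  | succ t ih => rw [state, normSq_unitary_mulVec, normSq_query, ih]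

theorem prob_mono (M : QuantumQueryAlgorithm Q n Out) (x : Q → Fin n) {P P' : Out → Prop}
    (h : ∀ o, P o → P' o) : M.prob x P ≤ M.prob x P' := by
  classical
  refine Finset.sum_le_sum fun s _ => ?_
  split_ifs with h1 h2
  · exact le_rfl
  · exact absurd (h _ h1) h2
  · positivity
  · exact le_rfl

theorem prob_eq_one (M : QuantumQueryAlgorithm Q n Out) (x : Q → Fin n) {P : Out → Prop}
    (h : ∀ o, P o) : M.prob x P = 1 := by
  rw [← normSq_state M x M.queries]
  exact Finset.sum_congr rfl fun s _ => if_pos (h _)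

/-- The same algorithm with the output processed further. -/
def mapOutput {Out' : Type} (M : QuantumQueryAlgorithm Q n Out) (g : Out → Out') :
    QuantumQueryAlgorithm Q n Out' :=
  { M with output := fun s => g (M.output s) }

theorem state_mapOutput {Out' : Type} (M : QuantumQueryAlgorithm Q n Out) (g : Out → Out')
    (x : Q → Fin n) (t : ℕ) : (M.mapOutput g).state x t = M.state x t := by
  induction t with
  | zero => rfl
  | succ t ih => simp only [state]; rw [ih]; rfl

theorem prob_mapOutput {Out' : Type} (M : QuantumQueryAlgorithm Q n Out) (g : Out → Out')
    (x : Q → Fin n) (P : Out' → Prop) :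
    (M.mapOutput g).prob x P = M.prob x fun o => P (g o) := by
  simp only [prob, state_mapOutput]
  rfl

/-- An algorithm can be specified by its intended states `φ t x` alone. Its actual start `φ₀` must
not depend on `x`, while `φ 0 x` may; the difference keeps its norm because queries and unitaries
are isometries. -/
theorem exists_of_gram {W : Type} [Fintype W] [DecidableEq W] [Nonempty W] (N : ℕ)
    (φ : ℕ → (Q → Fin n) → Option Q × Fin n × W → ℂ) (φ₀ : Option Q × Fin n × W → ℂ)
    (hφ₀ : normSq φ₀ = 1)
    (hstep : ∀ t < N, ∀ x y, star (query x (φ t x)) ⬝ᵥ query y (φ t y) =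
      star (φ (t + 1) x) ⬝ᵥ φ (t + 1) y) (out : Option Q × Fin n × W → Out) :
    ∃ M : QuantumQueryAlgorithm Q n Out, M.queries = N ∧ ∀ x,
      ∃ ψ : Option Q × Fin n × W → ℂ, normSq (ψ - φ N x) = normSq (φ₀ - φ 0 x) ∧
        ∀ P, M.prob x P = ∑ s, open Classical in if P (out s) then ‖ψ s‖ ^ 2 else 0 := by
  classical
  have hU : ∀ t, ∃ U : Matrix.unitaryGroup (Option Q × Fin n × W) ℂ, t < N →
      ∀ x, U.1.mulVec (query x (φ t x)) = φ (t + 1) x := fun t => by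
    by_cases ht : t < N
    · obtain ⟨U, hU⟩ := exists_unitary_of_gram (fun x => query x (φ t x)) (φ (t + 1))
        (hstep t ht)
      exact ⟨U, fun _ => hU⟩
    · exact ⟨1, fun h => absurd h ht⟩
  choose U hU using hU
  let s₀ : Option Q × Fin n × W := (none, 0, Classical.arbitrary W)
  obtain ⟨U₀, hU₀⟩ := exists_unitary_of_gram (fun _ : Unit => Pi.single s₀ (1 : ℂ))
    (fun _ => φ₀) fun _ _ => by
      rw [star_dotProduct_self_eq_normSq φ₀, hφ₀]
      simp [dotProduct, Pi.single_apply]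
  let M : QuantumQueryAlgorithm Q n Out :=
    { Work := W
      fintypeWork := inferInstance
      decidableEqWork := inferInstance
      queries := N
      start := s₀
      unitary := fun t => Nat.casesOn t U₀ U
      output := out }
  refine ⟨M, rfl, fun x => ⟨M.state x N, ?_, fun P => rfl⟩⟩
  have key : ∀ t ≤ N, normSq (M.state x t - φ t x) = normSq (φ₀ - φ 0 x) := fun t => by
    induction t with
    | zero =>
      intro _
      have : M.state x 0 = φ₀ := hU₀ ()
      rw [this]
    | succ t ih =>
      intro ht
      have h1 : M.state x (t + 1) = (U t).1.mulVec (query x (M.state x t)) := rfl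
      rw [h1, ← hU t ht x, ← Matrix.mulVec_sub]
      erw [← query_sub]
      rw [normSq_unitary_mulVec, normSq_query, ih (by omega)]
  exact key N le_rfl

end QuantumQueryAlgorithm

/-! ### Algorithms from a catalyst -/

theorem Fin.sum_ite_val_lt {K k : ℕ} (hk : k ≤ K) (a b : ℝ) :
    ∑ j : Fin K, (if j.val < k then a else b) = k * a + (K - k) * b := by
  rw [Fin.sum_univ_eq_sum_range (fun j => if j < k then a else b) K,
    ← Finset.sum_range_add_sum_Ico _ hk,
    Finset.sum_congr rfl (fun j hj => if_pos (Finset.mem_range.1 hj)),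
    Finset.sum_congr rfl (fun j hj => if_neg (not_lt.2 (Finset.mem_Ico.1 hj).1))]
  simp [Nat.cast_sub hk]

namespace QuantumQueryAlgorithm

variable {Q : Type} [Fintype Q] [DecidableEq Q] {n : ℕ} [NeZero n] {Out : Type}

/-- Let `v x` be a catalyst with which a query and a unitary independent of `x` turn `ξ` into `τ x`.
This is the state of the algorithm that starts with `K` copies of `ξ` in superposition and the
catalyst, after `k` of the copies have been turned into `τ x`. -/
noncomputable def catalystState {L : Type} (K : ℕ) (v : (Q → Fin n) → Q → Fin n → L → ℝ)
    (ξ : L → ℝ) (τ : (Q → Fin n) → L → ℝ) (k : ℕ) (x : Q → Fin n) :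
    Option Q × Fin n × (Fin K × L) → ℂ
  | (none, b, (j, l)) =>
    ((if b = 0 then (√K)⁻¹ * (if j.val < k then τ x l else ξ l) else 0 : ℝ) : ℂ)
  | (some q, b, (_, l)) => (((K : ℝ)⁻¹ * v x q b l : ℝ) : ℂ)

section

variable {L : Type} [Fintype L] {K : ℕ} (v : (Q → Fin n) → Q → Fin n → L → ℝ)
    (ξ : L → ℝ) (τ : (Q → Fin n) → L → ℝ)

theorem catalystState_public_sum (hξ : ∑ l, ξ l * ξ l = 1) {k : ℕ} (hk : k ≤ K)
    (x y : Q → Fin n) :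
    ∑ b : Fin n, ∑ j : Fin K, ∑ l : L,
      (if b = 0 then (√K)⁻¹ * (if j.val < k then τ x l else ξ l) else 0) *
      (if b = 0 then (√K)⁻¹ * (if j.val < k then τ y l else ξ l) else 0) =
    (K : ℝ)⁻¹ * (k * ∑ l, τ x l * τ y l + (K - k)) := by
  have hs : (√K)⁻¹ * (√K)⁻¹ = (K : ℝ)⁻¹ := by
    rw [← mul_inv, Real.mul_self_sqrt (Nat.cast_nonneg K)]
  rw [Finset.sum_eq_single (0 : Fin n) (by simp +contextual) (by simp)]
  simp only [if_true]
  have : ∀ j : Fin K, ∑ l, (√K)⁻¹ * (if j.val < k then τ x l else ξ l) *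
      ((√K)⁻¹ * (if j.val < k then τ y l else ξ l)) =
      (K : ℝ)⁻¹ * (if j.val < k then ∑ l, τ x l * τ y l else 1) := fun j => by
    split_ifs
    · rw [← hs, Finset.mul_sum]
      exact Finset.sum_congr rfl fun l _ => by ring
    · rw [← hs, ← hξ, Finset.mul_sum]
      exact Finset.sum_congr rfl fun l _ => by ring
  rw [Finset.sum_congr rfl fun j _ => this j, ← Finset.mul_sum, Fin.sum_ite_val_lt hk, mul_one]

theorem catalystState_private_sum (hK : 0 < K) (f g : Q → Fin n → L → ℝ) :
    ∑ q, ∑ b, ∑ _j : Fin K, ∑ l, ((K : ℝ)⁻¹ * f q b l) * ((K : ℝ)⁻¹ * g q b l) =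
      (K : ℝ)⁻¹ * ∑ q, ∑ b, ∑ l, f q b l * g q b l := by
  have hK' : (K : ℝ) ≠ 0 := by positivity
  simp only [Finset.mul_sum, Finset.sum_const, Finset.card_univ, Fintype.card_fin, nsmul_eq_mul]
  refine Finset.sum_congr rfl fun q _ => Finset.sum_congr rfl fun b _ =>
    Finset.sum_congr rfl fun l _ => ?_
  field_simp

theorem gram_catalystState (hK : 0 < K) (hξ : ∑ l, ξ l * ξ l = 1) {k : ℕ} (hk : k ≤ K)
    (x y : Q → Fin n) :
    star (catalystState K v ξ τ k x) ⬝ᵥ catalystState K v ξ τ k y =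
      (((K : ℝ)⁻¹ * (k * ∑ l, τ x l * τ y l + (K - k) +
        ∑ q, ∑ b, ∑ l, v x q b l * v y q b l) : ℝ) : ℂ) := by
  rw [mul_add, ← catalystState_public_sum ξ τ hξ hk, ← catalystState_private_sum hK]
  simp only [dotProduct, Fintype.sum_prod_type, Fintype.sum_option, catalystState, Pi.star_apply,
    RCLike.star_def, Complex.conj_ofReal]
  push_cast
  rfl

theorem gram_query_catalystState (hK : 0 < K) (hξ : ∑ l, ξ l * ξ l = 1) {k : ℕ} (hk : k ≤ K)
    (x y : Q → Fin n) :
    star (query x (catalystState K v ξ τ k x)) ⬝ᵥ query y (catalystState K v ξ τ k y) =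
      (((K : ℝ)⁻¹ * (k * ∑ l, τ x l * τ y l + (K - k) +
        ∑ q, ∑ b, ∑ l, v x q (b - x q) l * v y q (b - y q) l) : ℝ) : ℂ) := by
  rw [mul_add, ← catalystState_public_sum ξ τ hξ hk,
    ← catalystState_private_sum hK (fun q b l => v x q (b - x q) l)]
  simp only [dotProduct, Fintype.sum_prod_type, Fintype.sum_option, catalystState, Pi.star_apply,
    RCLike.star_def, Complex.conj_ofReal, query]
  push_cast
  rfl

theorem normSq_sub_catalystState (hK : 0 < K) (x : Q → Fin n) :
    normSq (catalystState K 0 ξ τ 0 x - catalystState K v ξ τ 0 x) =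
      (K : ℝ)⁻¹ * ∑ q, ∑ b, ∑ l, v x q b l * v x q b l := by
  rw [← catalystState_private_sum hK]
  simp only [normSq, Fintype.sum_prod_type, Fintype.sum_option, catalystState, Pi.sub_apply,
    sub_self, norm_zero, Pi.zero_apply, mul_zero, Complex.ofReal_zero, zero_sub, norm_neg,
    Complex.norm_real, Real.norm_eq_abs, sq_abs]
  simp [sq]

/-- By `hgram`, one query restores the catalyst and converts one copy of `ξ` into `τ x`; after `K`
queries all copies are converted. The algorithm starts without the catalyst, an error of square norm
`‖v x‖² / K ≤ 1/36`. -/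
theorem exists_of_catalyst [DecidableEq L] (hK : 0 < K) (hξ : ∑ l, ξ l * ξ l = 1)
    (hτ : ∀ x, ∑ l, τ x l * τ x l = 1)
    (hgram : ∀ x y, 1 + ∑ q, ∑ b, ∑ l, v x q (b - x q) l * v y q (b - y q) l =
      ∑ l, τ x l * τ y l + ∑ q, ∑ b, ∑ l, v x q b l * v y q b l) (out : L → Out) :
    ∃ M : QuantumQueryAlgorithm Q n Out, M.queries = K ∧ ∀ x (P : Out → Prop),
      (∀ l, τ x l ≠ 0 → P (out l)) → 36 * ∑ q, ∑ b, ∑ l, v x q b l * v x q b l ≤ K →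
      2 / 3 ≤ M.prob x P := by
  classical
  have hK' : (K : ℝ) ≠ 0 := by positivity
  have : NeZero K := ⟨hK.ne'⟩
  have : Nonempty L := by
    by_contra h
    rw [not_nonempty_iff] at h
    simp at hξ
  obtain ⟨M, hM, hMx⟩ := exists_of_gram (Q := Q) (n := n) (Out := Out) (W := Fin K × L) K
    (catalystState K v ξ τ) (catalystState K 0 ξ τ 0 0) (by
      have h := star_dotProduct_self_eq_normSq (catalystState K 0 ξ τ 0 (0 : Q → Fin n))
      rw [gram_catalystState 0 ξ τ hK hξ (Nat.zero_le K)] at h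
      have h' := Complex.ofReal_injective h
      rw [← h']
      simp [hK']) (fun t ht x y => by
      rw [gram_query_catalystState v ξ τ hK hξ ht.le, gram_catalystState v ξ τ hK hξ ht]
      have := hgram x y
      congr 2
      push_cast
      linarith) (fun s => out s.2.2.2)
  refine ⟨M, hM, fun x P hP hx => ?_⟩
  obtain ⟨ψ, hψ, hprob⟩ := hMx x
  rw [hprob]
  have hδ : normSq (ψ - catalystState K v ξ τ K x) ≤ 1 / 36 := by
    rw [hψ]
    have h0 : catalystState K 0 ξ τ 0 (0 : Q → Fin n) = catalystState K 0 ξ τ 0 x := by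
      funext ⟨q, b, j, l⟩
      cases q <;> simp [catalystState]
    rw [h0, normSq_sub_catalystState v ξ τ hK, inv_mul_le_iff₀ (by positivity)]
    linarith
  have hideal : 1 ≤ ∑ s, if P (out s.2.2.2) then ‖catalystState K v ξ τ K x s‖ ^ 2 else 0 := by
    have h1 := catalystState_public_sum ξ τ hξ (le_refl K) x x
    rw [hτ, mul_one, sub_self, add_zero, inv_mul_cancel₀ hK'] at h1
    rw [← h1]
    simp only [Fintype.sum_prod_type, Fintype.sum_option]
    refine le_add_of_le_of_nonneg (le_of_eq ?_) (by positivity)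
    refine Finset.sum_congr rfl fun b _ => Finset.sum_congr rfl fun j _ =>
      Finset.sum_congr rfl fun l _ => ?_
    simp only [catalystState, Complex.norm_real, Real.norm_eq_abs, sq_abs, j.2, if_true]
    by_cases hl : τ x l = 0
    · simp [hl]
    · rw [if_pos (hP l hl), sq]
  -- Weighted so that the error `1/36` leaves the probability `5/6 - 5/36 = 25/36 ≥ 2/3`.
  have hpt : ∀ z w : ℂ, 5 / 6 * ‖w‖ ^ 2 - 5 * ‖z - w‖ ^ 2 ≤ ‖z‖ ^ 2 := fun z w => by
    have h1 : ‖w‖ ≤ ‖z‖ + ‖z - w‖ := by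
      have := norm_sub_le z (z - w)
      rwa [sub_sub_cancel] at this
    nlinarith [sq_nonneg (‖z‖ - 5 * ‖z - w‖), norm_nonneg w, norm_nonneg z, norm_nonneg (z - w)]
  have hsum : 5 / 6 * (∑ s, if P (out s.2.2.2) then ‖catalystState K v ξ τ K x s‖ ^ 2 else 0) -
      5 * normSq (ψ - catalystState K v ξ τ K x) ≤
      ∑ s, if P (out s.2.2.2) then ‖ψ s‖ ^ 2 else 0 := by
    rw [normSq, Finset.mul_sum, Finset.mul_sum, ← Finset.sum_sub_distrib]
    refine Finset.sum_le_sum fun s _ => ?_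
    split_ifs
    · exact hpt _ _
    · simp
  linarith

end

end QuantumQueryAlgorithm

/-! ### Classical queries after the measurement -/

namespace QuantumQueryAlgorithm

variable {Q : Type} [Fintype Q] [DecidableEq Q] {n : ℕ} [NeZero n] {Out : Type}

theorem _root_.Fintype.sum_sum_sum_sum_eq {α β γ δ R : Type} [Fintype α] [Fintype β] [Fintype γ]
    [Fintype δ] [AddCommMonoid R] (F : γ → α × β × δ → R) :
    ∑ a, ∑ b, ∑ s, ∑ y, F s (a, b, y) = ∑ s, ∑ p, F s p := by
  simp only [Fintype.sum_prod_type]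
  rw [Finset.sum_comm (s := (Finset.univ : Finset γ))]
  exact Finset.sum_congr rfl fun a _ => Finset.sum_comm

/-- The measurement is deferred. The final basis state `s` of `M` is kept as a label, the positions
in `S` are queried one by one, and the answers are recorded. All intended states start from an
input-independent one, so the simulation is exact. -/
theorem exists_postprocessing {Out' : Type} (M : QuantumQueryAlgorithm Q n Out)
    (S : Out → Finset Q) (k : ℕ) (hk : ∀ o, (S o).card ≤ k) (g : Out → (Q → Fin n) → Out')
    (hg : ∀ o x y, (∀ q ∈ S o, x q = y q) → g o x = g o y) :
    ∃ M' : QuantumQueryAlgorithm Q n Out', M'.queries = M.queries + k ∧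
      ∀ x P, M'.prob x P = M.prob x fun o => P (g o x) := by
  classical
  let B := Option Q × Fin n × M.Work
  let ℓ : B → List Q := fun s => (S (M.output s)).toList
  -- The answers known after `i` of the additional queries, with `0` at the other positions.
  let mask : ℕ → B → (Q → Fin n) → Q → Fin n := fun i s x q =>
    if q ∈ (ℓ s).take i then x q else 0
  -- From time `M.queries` on, the amplitude of `s` sits at the label `s` with the answers obtained
  -- so far, and the next position is already in the query register. Branches of two inputs overlap
  -- exactly when these answers agree.
  let φ : ℕ → (Q → Fin n) → Option Q × Fin n × (M.Work ⊕ (B × (Q → Fin n))) → ℂ :=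
    fun t x s => match s with
      | (q, b, Sum.inl w) => if t < M.queries then M.state x t (q, b, w) else 0
      | (q, b, Sum.inr (s, y)) => if t < M.queries then 0 else
        if (q, b, y) = ((ℓ s)[t - M.queries]?, (0 : Fin n), mask (t - M.queries) s x) then
          M.state x M.queries s else 0
  have hφ1 : ∀ t < M.queries, ∀ x y, star (φ t x) ⬝ᵥ φ t y =
      star (M.state x t) ⬝ᵥ M.state y t := fun t ht x y => by
    simp [dotProduct, Fintype.sum_prod_type, Fintype.sum_sum_type, φ, ht]
  have hφ2 : ∀ t < M.queries, ∀ x y, star (query x (φ t x)) ⬝ᵥ query y (φ t y) =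
      star (M.state x (t + 1)) ⬝ᵥ M.state y (t + 1) := fun t ht x y => by
    simp only [state]
    rw [star_unitary_mulVec_dotProduct]
    simp [dotProduct, Fintype.sum_prod_type, Fintype.sum_sum_type, Fintype.sum_option, query,
      φ, ht]
  have hφ3 : ∀ i x y, star (φ (M.queries + i) x) ⬝ᵥ φ (M.queries + i) y =
    ∑ s, if mask i s x = mask i s y then star (M.state x M.queries s) * M.state y M.queries s
      else 0 := fun i x y => by
    simp only [dotProduct, Fintype.sum_prod_type (α₁ := Option Q),
      Fintype.sum_prod_type (α₁ := Fin n) (α₂ := M.Work ⊕ (B × (Q → Fin n))),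
      Fintype.sum_sum_type, Fintype.sum_prod_type (α₁ := B), φ,
      Pi.star_apply, not_lt.2 (Nat.le_add_right _ _), if_false, star_zero, zero_mul,
      Finset.sum_const_zero, zero_add, Nat.add_sub_cancel_left, apply_ite (star : ℂ → ℂ)]
    rw [Fintype.sum_sum_sum_sum_eq fun s p => (if p = _ then star (M.state x M.queries s) else 0) *
      (if p = _ then M.state y M.queries s else 0)]
    refine Finset.sum_congr rfl fun s _ => ?_
    rw [Finset.sum_eq_single _ (fun p _ hp => by rw [if_neg hp, zero_mul]) (by simp), if_pos rfl,
      mul_ite, mul_zero]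
    simp
  have hquery : ∀ i x q b s y, query x (φ (M.queries + i) x) (q, b, Sum.inr (s, y)) =
      if (q, b, y) = ((ℓ s)[i]?, (ℓ s)[i]?.elim 0 x, mask i s x) then M.state x M.queries s
        else 0 := fun i x q b s y => by
    cases q with
    | none =>
      simp only [query, φ, not_lt.2 (Nat.le_add_right _ _), if_false, Nat.add_sub_cancel_left,
        Prod.mk.injEq]
      refine if_congr ?_ rfl rfl
      constructor <;> rintro ⟨h1, h2, h3⟩ <;> refine ⟨h1, ?_, h3⟩
      · rw [h2, ← h1]; rfl
      · rw [h2, ← h1]; rfl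
    | some q =>
      simp only [query, φ, not_lt.2 (Nat.le_add_right _ _), if_false, Nat.add_sub_cancel_left,
        Prod.mk.injEq]
      refine if_congr ?_ rfl rfl
      constructor <;> rintro ⟨h1, h2, h3⟩ <;> refine ⟨h1, ?_, h3⟩
      · rw [← h1]; exact sub_eq_zero.1 h2
      · rw [h2, ← h1]; exact sub_self _
  have hmask : ∀ i s x y, (((ℓ s)[i]?, (ℓ s)[i]?.elim 0 x, mask i s x) :
      Option Q × Fin n × (Q → Fin n)) = ((ℓ s)[i]?, (ℓ s)[i]?.elim 0 y, mask i s y) ↔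
      mask (i + 1) s x = mask (i + 1) s y := fun i s x y => by
    have hm : ∀ i, mask i s x = mask i s y ↔ ∀ q ∈ (ℓ s).take i, x q = y q := fun i => by
      simp only [mask, funext_iff]
      refine forall_congr' fun q => ?_
      by_cases hq : q ∈ (ℓ s).take i <;> simp [hq]
    rw [hm, Prod.mk.injEq, Prod.mk.injEq, hm, List.take_add_one]
    cases (ℓ s)[i]? <;> simp [or_imp, forall_and, and_comm]
  have hφ4 : ∀ i x y, star (query x (φ (M.queries + i) x)) ⬝ᵥ query y (φ (M.queries + i) y) =
    ∑ s, if mask (i + 1) s x = mask (i + 1) s y then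
      star (M.state x M.queries s) * M.state y M.queries s else 0 := fun i x y => by
    have hl : ∀ x q b w, query x (φ (M.queries + i) x) (q, b, Sum.inl w) = 0 := fun x q b w => by
      cases q <;> simp [query, φ]
    simp only [dotProduct, Fintype.sum_prod_type (α₁ := Option Q),
      Fintype.sum_prod_type (α₁ := Fin n) (α₂ := M.Work ⊕ (B × (Q → Fin n))),
      Fintype.sum_sum_type, Fintype.sum_prod_type (α₁ := B), hquery, hl,
      Pi.star_apply, star_zero, zero_mul,
      Finset.sum_const_zero, zero_add, apply_ite (star : ℂ → ℂ)]
    rw [Fintype.sum_sum_sum_sum_eq fun s p => (if p = _ then star (M.state x M.queries s) else 0) *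
      (if p = _ then M.state y M.queries s else 0)]
    refine Finset.sum_congr rfl fun s _ => ?_
    rw [Finset.sum_eq_single _ (fun p _ hp => by rw [if_neg hp, zero_mul]) (by simp), if_pos rfl,
      mul_ite, mul_zero]
    exact if_congr (hmask i s x y) rfl rfl
  have hφ5 : ∀ t ≤ M.queries, ∀ x y, star (φ t x) ⬝ᵥ φ t y =
      star (M.state x t) ⬝ᵥ M.state y t := fun t ht x y => by
    rcases ht.lt_or_eq with h | rfl
    · exact hφ1 t h x y
    · have := hφ3 0 x y
      rw [add_zero] at this
      rw [this]
      simp only [mask, List.take_zero, List.not_mem_nil, if_false, if_true]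
      rfl
  have hφ0 : ∀ x, φ 0 x = φ 0 0 := fun x => by
    have h0 : ∀ x, M.state x 0 = M.state 0 0 := fun x => rfl
    funext ⟨q, b, w⟩
    rcases w with w | ⟨s, y⟩
    · simp only [φ, h0 x]
    · by_cases h : 0 < M.queries
      · simp only [φ, h, if_true]
      · have h' : M.queries = 0 := by omega
        simp only [φ, h', lt_irrefl, if_false, h0 x, mask, Nat.sub_zero, List.take_zero,
          List.not_mem_nil]
  have : Nonempty (M.Work ⊕ (B × (Q → Fin n))) := ⟨Sum.inl M.start.2.2⟩
  obtain ⟨M', hM', hx⟩ := exists_of_gram (M.queries + k) φ (φ 0 0) (by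
      have h1 := hφ5 0 (Nat.zero_le _) 0 0
      rw [star_dotProduct_self_eq_normSq, star_dotProduct_self_eq_normSq, normSq_state] at h1
      exact_mod_cast h1) (fun t ht x y => by
      by_cases h : t < M.queries
      · rw [hφ2 t h, hφ5 (t + 1) h]
      · obtain ⟨i, rfl⟩ := Nat.exists_eq_add_of_le (not_lt.1 h)
        rw [hφ4, add_assoc, hφ3])
    -- The first branch is a default: its amplitude is zero at the end.
    (fun s => match s with
      | (_, _, Sum.inl _) => g (M.output M.start) 0
      | (_, _, Sum.inr (s, y)) => g (M.output s) y)
  refine ⟨M', hM', fun x P => ?_⟩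
  obtain ⟨ψ, hψ, hP⟩ := hx x
  have hψ' : ψ = φ (M.queries + k) x := by
    rw [hφ0 x, sub_self] at hψ
    simp only [normSq, Pi.zero_apply, norm_zero] at hψ
    rw [Finset.sum_congr rfl fun _ _ => zero_pow two_ne_zero, Finset.sum_const_zero,
      Finset.sum_eq_zero_iff_of_nonneg fun _ _ => by positivity] at hψ
    funext s
    simpa [sub_eq_zero] using hψ s (Finset.mem_univ s)
  have hgx : ∀ s, g (M.output s) (mask k s x) = g (M.output s) x := fun s => by
    refine hg _ _ _ fun q hq => ?_
    have : q ∈ (ℓ s).take k := by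
      rw [List.take_of_length_le (by rw [Finset.length_toList]; exact hk _)]
      exact Finset.mem_toList.2 hq
    simp only [mask, this, if_true]
  rw [hP, hψ', prob]
  simp only [Fintype.sum_prod_type (α₁ := Option Q),
      Fintype.sum_prod_type (α₁ := Fin n) (α₂ := M.Work ⊕ (B × (Q → Fin n))),
      Fintype.sum_sum_type, Fintype.sum_prod_type (α₁ := B), φ,
      not_lt.2 (Nat.le_add_right _ _), if_false, norm_zero, Nat.add_sub_cancel_left]
  refine Eq.trans (b := ∑ s : B, ∑ p : Option Q × Fin n × (Q → Fin n),
    if p = ((ℓ s)[k]?, (0 : Fin n), mask k s x) then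
      if P (g (M.output s) x) then ‖M.state x M.queries s‖ ^ 2 else 0 else 0) ?_ ?_
  · rw [← Fintype.sum_sum_sum_sum_eq]
    refine Finset.sum_congr rfl fun q _ => Finset.sum_congr rfl fun b _ => ?_
    rw [Finset.sum_eq_zero fun w _ => by simp, zero_add]
    refine Finset.sum_congr rfl fun s _ => Finset.sum_congr rfl fun y _ => ?_
    by_cases h : (q, b, y) = ((ℓ s)[k]?, (0 : Fin n), mask k s x)
    · have hy : y = mask k s x := congrArg (fun p => p.2.2) h
      rw [if_pos h, if_pos h, hy, hgx]
    · simp [h]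
  · simp only [Finset.sum_ite_eq', Finset.mem_univ, if_true]
    exact Fintype.sum_prod_type _

theorem exists_constant (o : Out) : ∃ M : QuantumQueryAlgorithm Q n Out, M.queries = 0 ∧
    ∀ x P, P o → M.prob x P = 1 := by
  let M : QuantumQueryAlgorithm Q n Out :=
    { Work := Unit
      fintypeWork := inferInstance
      decidableEqWork := inferInstance
      queries := 0
      start := (none, 0, ())
      unitary := fun _ => 1
      output := fun _ => o }
  refine ⟨M, rfl, fun x P h => ?_⟩
  rw [← normSq_state M x M.queries]
  exact Finset.sum_congr rfl fun s _ => if_pos h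

end QuantumQueryAlgorithm

/-! ### Quantum simulation of guessing machines -/

section NodeVector

variable {n : ℕ} [NeZero n]

/-- The amplitudes of the query made at a node of a decision tree whose answer is `z`; here `p` says
that the answer has been predicted, and `a` is the weight of a predicted answer. -/
noncomputable def nodeVector (a : ℝ) (z : Fin n) (p : Prop) [Decidable p] (b : Fin n) (e : Fin 3) :
    ℝ :=
  ![(if b = 0 then 1 else 0) * (if p then √a else (√a)⁻¹),
    (if b = -z then 1 else 0) * (if p then 0 else √(a⁻¹ - 1)),
    (if b = -z then 1 else 0) * (if p then √a else 0)] e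

theorem sum_nodeVector_mul (a : ℝ) (z z' : Fin n) (p p' : Prop) [Decidable p] [Decidable p'] :
    ∑ b, ∑ e, nodeVector a z p b e * nodeVector a z' p' b e =
      (if p then √a else (√a)⁻¹) * (if p' then √a else (√a)⁻¹) +
      (if z = z' then 1 else 0) * ((if p then 0 else √(a⁻¹ - 1)) * (if p' then 0 else √(a⁻¹ - 1)) +
        (if p then √a else 0) * (if p' then √a else 0)) := by
  simp only [Fin.sum_univ_three, nodeVector, Matrix.cons_val, mul_mul_mul_comm (ite (_ = _) _ _),
    Finset.sum_add_distrib, ← Finset.sum_mul]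
  have h1 : ∑ b : Fin n, (if b = 0 then (1 : ℝ) else 0) * (if b = 0 then 1 else 0) = 1 := by simp
  have h2 : ∑ b : Fin n, (if b = -z then (1 : ℝ) else 0) * (if b = -z' then 1 else 0) =
      if z = z' then 1 else 0 := by simp [eq_comm]
  rw [h1, h2]
  ring

theorem sum_shifted_nodeVector_mul (a : ℝ) (z z' : Fin n) (p p' : Prop) [Decidable p]
    [Decidable p'] :
    ∑ b, ∑ e, nodeVector a z p (b - z) e * nodeVector a z' p' (b - z') e =
      (if z = z' then 1 else 0) *
        ((if p then √a else (√a)⁻¹) * (if p' then √a else (√a)⁻¹)) +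
      ((if p then 0 else √(a⁻¹ - 1)) * (if p' then 0 else √(a⁻¹ - 1)) +
        (if p then √a else 0) * (if p' then √a else 0)) := by
  simp only [Fin.sum_univ_three, nodeVector, Matrix.cons_val, mul_mul_mul_comm (ite (_ = _) _ _),
    Finset.sum_add_distrib, ← Finset.sum_mul]
  have h1 : ∑ b : Fin n, (if b - z = 0 then (1 : ℝ) else 0) * (if b - z' = 0 then 1 else 0) =
      if z = z' then 1 else 0 := by simp [sub_eq_zero, eq_comm]
  have h2 : ∑ b : Fin n, (if b - z = -z then (1 : ℝ) else 0) * (if b - z' = -z' then 1 else 0) =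
      1 := by simp [sub_eq_neg_self]
  rw [h1, h2]
  ring

/-- For `z ≠ z'` the query makes the first components orthogonal and brings the other two to the
common answer `0`. The change of the inner product is `a - a` if both answers are predicted, `√a /
√a` if one is, and `a⁻¹ - (a⁻¹ - 1)` if none is. For `z = z'` nothing changes. -/
theorem sum_nodeVector_sub {a : ℝ} (ha : 0 < a) (ha1 : a ≤ 1) (z z' : Fin n) (p p' : Prop)
    [Decidable p] [Decidable p'] :
    ∑ b, ∑ e, nodeVector a z p b e * nodeVector a z' p' b e -
      ∑ b, ∑ e, nodeVector a z p (b - z) e * nodeVector a z' p' (b - z') e =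
      if z = z' ∨ (p ∧ p') then 0 else 1 := by
  rw [sum_nodeVector_mul, sum_shifted_nodeVector_mul]
  have h1 : √a * √a = a := Real.mul_self_sqrt ha.le
  have h2 : (√a)⁻¹ * (√a)⁻¹ = a⁻¹ := by rw [← mul_inv, h1]
  have h3 : √(a⁻¹ - 1) * √(a⁻¹ - 1) = a⁻¹ - 1 :=
    Real.mul_self_sqrt (sub_nonneg.2 ((one_le_inv₀ ha).2 ha1))
  have h4 : √a ≠ 0 := (Real.sqrt_pos.2 ha).ne'
  by_cases hz : z = z' <;> by_cases hp : p <;> by_cases hp' : p' <;>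
    simp [hz, hp, hp', h1, h2, h3, h4]

theorem sum_nodeVector_self {a : ℝ} (ha : 0 < a) (ha1 : a ≤ 1) (z : Fin n) (p : Prop)
    [Decidable p] :
    ∑ b, ∑ e, nodeVector a z p b e * nodeVector a z p b e =
      if p then 2 * a else 2 * a⁻¹ - 1 := by
  rw [sum_nodeVector_mul]
  have h1 : √a * √a = a := Real.mul_self_sqrt ha.le
  have h2 : (√a)⁻¹ * (√a)⁻¹ = a⁻¹ := by rw [← mul_inv, h1]
  have h3 : √(a⁻¹ - 1) * √(a⁻¹ - 1) = a⁻¹ - 1 :=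
    Real.mul_self_sqrt (sub_nonneg.2 ((one_le_inv₀ ha).2 ha1))
  by_cases hp : p <;> simp [hp, h1, h2, h3] <;> ring

end NodeVector

section LabelledAmplitude

variable {Q β ε κ η δ : Type} [Fintype Q] [DecidableEq Q] [Fintype β] [Fintype ε] [Fintype κ]
  [Fintype η] [DecidableEq η] [Fintype δ]

/-- The amplitudes `f k q b e`, where `q` is the query `pos k`, tagged with the label `h k`. -/
def labelledAmplitude (pos : κ → Option Q) (h : κ → η) (f : κ → Q → β → ε → ℝ) (q : Q) (b : β) :
    δ ⊕ (κ × η × ε) → ℝ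
  | Sum.inl _ => 0
  | Sum.inr (k, h', e) => if pos k = some q ∧ h k = h' then f k q b e else 0

/-- Different labels are orthogonal, and by `hpos` equal labels come with equal positions. -/
theorem sum_labelledAmplitude_mul (pos pos' : κ → Option Q) (h h' : κ → η)
    (f f' : κ → Q → β → ε → ℝ) (hpos : ∀ k, h k = h' k → pos k = pos' k) :
    ∑ q, ∑ b, ∑ l : δ ⊕ (κ × η × ε),
      labelledAmplitude pos h f q b l * labelledAmplitude pos' h' f' q b l =
    ∑ k, if h k = h' k then
      (pos k).elim 0 fun q => ∑ b, ∑ e, f k q b e * f' k q b e else 0 := by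
  simp only [Fintype.sum_sum_type, labelledAmplitude, zero_mul, Finset.sum_const_zero, zero_add,
    Fintype.sum_prod_type]
  rw [Finset.sum_congr rfl fun q _ => Finset.sum_comm, Finset.sum_comm]
  refine Finset.sum_congr rfl fun k _ => ?_
  cases hk : pos k with
  | none => simp
  | some q =>
    rw [Finset.sum_eq_single q (fun q' _ hq' => by simp [hq'.symm]) (by simp)]
    split_ifs with hh
    · refine Finset.sum_congr rfl fun b _ => ?_
      rw [Finset.sum_eq_single (h k) (fun j _ hj => by simp [hj.symm]) (by simp)]
      simp [← hpos k hh, hk, ← hh]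
    · refine Finset.sum_eq_zero fun b _ => Finset.sum_eq_zero fun j _ =>
        Finset.sum_eq_zero fun e _ => ?_
      by_cases hj : h k = j
      · rw [if_neg (c := _ ∧ h' k = j) fun hc => hh (hj.trans hc.2.symm), mul_zero]
      · simp [hj]

end LabelledAmplitude

/-- A deterministic adaptive procedure that makes at most one query per step, and predicts the set
of the possible answers. It learns only whether the prediction is right, and it learns the answer
if the prediction is wrong. -/
structure GuessingMachine (Q : Type) (n : ℕ) where
  /-- the states -/
  State : Type
  /-- the initial state -/
  init : State
  /-- the position that is queried next -/
  pos : State → Option Q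
  /-- the predicted answers -/
  predicted : State → Fin n → Prop
  /-- the next state, given the answer unless it has been predicted -/
  next : State → Option (Fin n) → State

namespace GuessingMachine

variable {Q : Type} {n : ℕ} (G : GuessingMachine Q n)

open Classical in
/-- The answer that the machine gets in the state `s`, if it has not been predicted. -/
noncomputable def surprise (x : Q → Fin n) (s : G.State) : Option (Fin n) :=
  (G.pos s).elim none fun q => if G.predicted s (x q) then none else some (x q)

/-- The state after `t` steps. -/
noncomputable def run (x : Q → Fin n) : ℕ → G.State
  | 0 => G.init
  | t + 1 => G.next (run x t) (G.surprise x (run x t))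

/-- The surprises in the first `t` of `T` steps. -/
noncomputable def history (T t : ℕ) (x : Q → Fin n) : Fin T → Option (Fin n) := fun r =>
  if r.val < t then G.surprise x (G.run x r) else none

open Classical in
/-- The contribution of the state `s` to the complexity, when predicted answers have weight `a`. -/
noncomputable def cost (a : ℝ) (x : Q → Fin n) (s : G.State) : ℝ :=
  (G.pos s).elim 0 fun q => if G.predicted s (x q) then 2 * a else 2 * a⁻¹ - 1

/-- The machine is deterministic and sees the input only through its surprises. -/
theorem run_eq_of_history_eq {T t : ℕ} {x y : Q → Fin n} (ht : t ≤ T)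
    (h : G.history T t x = G.history T t y) : ∀ r ≤ t, G.run x r = G.run y r := by
  intro r
  induction r with
  | zero => exact fun _ => rfl
  | succ r ih =>
    intro hr
    have h1 := congrFun h ⟨r, by omega⟩
    simp only [history, show r < t by omega, if_true] at h1
    rw [run, run, h1, ih (by omega)]

theorem history_succ_eq_iff {T t : ℕ} (ht : t < T) (x y : Q → Fin n) :
    G.history T (t + 1) x = G.history T (t + 1) y ↔ G.history T t x = G.history T t y ∧
      G.surprise x (G.run x t) = G.surprise y (G.run y t) := by
  simp only [history, funext_iff]
  constructor
  · intro h
    refine ⟨fun r => ?_, ?_⟩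
    · by_cases hr : r.val < t
      · have := h r
        simpa [hr, Nat.lt_succ_of_lt hr] using this
      · simp [hr]
    · simpa using h ⟨t, ht⟩
  · rintro ⟨h1, h2⟩ r
    rcases lt_trichotomy r.val t with hr | hr | hr
    · have := h1 r
      simpa [hr, Nat.lt_succ_of_lt hr] using this
    · simp [hr, h2]
    · simp [show ¬ r.val < t + 1 by omega]

variable [Fintype Q] [DecidableEq Q] [NeZero n] {Out : Type}

open Classical in
-- The inner products at step `t` change by `1` exactly when the two histories first differ there;
-- the right side is written as a difference so that the sum over `t` telescopes.
theorem sum_nodeVector_sub_eq {a : ℝ} (ha : 0 < a) (ha1 : a ≤ 1) {T t : ℕ} (ht : t < T)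
    (x y : Q → Fin n) :
    (if G.history T t x = G.history T t y then (G.pos (G.run x t)).elim 0 fun q => ∑ b, ∑ e,
      nodeVector a (x q) (G.predicted (G.run x t) (x q)) b e *
      nodeVector a (y q) (G.predicted (G.run y t) (y q)) b e else 0) -
    (if G.history T t x = G.history T t y then (G.pos (G.run x t)).elim 0 fun q => ∑ b, ∑ e,
      nodeVector a (x q) (G.predicted (G.run x t) (x q)) (b - x q) e *
      nodeVector a (y q) (G.predicted (G.run y t) (y q)) (b - y q) e else 0) =
    (if G.history T t x = G.history T t y then 1 else 0) -
      (if G.history T (t + 1) x = G.history T (t + 1) y then 1 else 0) := by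
  by_cases h : G.history T t x = G.history T t y
  · have hr := G.run_eq_of_history_eq ht.le h t le_rfl
    simp only [history_succ_eq_iff G ht, h, true_and, if_true, surprise, ← hr]
    cases hp : G.pos (G.run x t) with
    | none => simp
    | some q =>
      simp only [Option.elim_some]
      rw [sum_nodeVector_sub ha ha1]
      by_cases hz : x q = y q
      · simp [hz]
      · by_cases h1 : G.predicted (G.run x t) (x q) <;>
          by_cases h2 : G.predicted (G.run x t) (y q) <;> simp [hz, h1, h2]
  · simp [history_succ_eq_iff G ht, h]

/-- The catalyst collects the node vectors along the run, labelled by the history and averaged over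
`i`, so its square norm is the average cost. The target state is the uniform superposition of the
pairs of `i` and its complete history, hence `P` must hold for every `i` while only the average cost
must be small. -/
theorem exists_algorithm {ι : Type} [Fintype ι] [DecidableEq ι] [Nonempty ι]
    (G : ι → GuessingMachine Q n) (T : ℕ) {a : ℝ} (ha : 0 < a) (ha1 : a ≤ 1) {K : ℕ} (hK : 0 < K)
    (out : ∀ i, (G i).State → Out) :
    ∃ M : QuantumQueryAlgorithm Q n Out, M.queries = K ∧ ∀ x (P : Out → Prop),
      (∀ i, P (out i ((G i).run x T))) →
      36 * ((Fintype.card ι : ℝ)⁻¹ * ∑ i, ∑ t ∈ Finset.range T, (G i).cost a x ((G i).run x t)) ≤ K →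
      2 / 3 ≤ M.prob x P := by
  classical
  let η := Fin T → Option (Fin n)
  let c : ℝ := √(Fintype.card ι : ℝ)⁻¹
  have hc : c * c = (Fintype.card ι : ℝ)⁻¹ := Real.mul_self_sqrt (by positivity)
  have hcard : (Fintype.card ι : ℝ) ≠ 0 := by simp
  let pos : (Q → Fin n) → ι × Fin T → Option Q := fun x k => (G k.1).pos ((G k.1).run x k.2)
  let hist : (Q → Fin n) → ι × Fin T → η := fun x k => (G k.1).history T k.2 x
  let f : (Q → Fin n) → ι × Fin T → Q → Fin n → Fin 3 → ℝ := fun x k q b e =>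
    c * nodeVector a (x q) ((G k.1).predicted ((G k.1).run x k.2) (x q)) b e
  let v : (Q → Fin n) → Q → Fin n → (ι × η) ⊕ ((ι × Fin T) × η × Fin 3) → ℝ := fun x =>
    labelledAmplitude (pos x) (hist x) (f x)
  let μ : (ι → η) → (ι × η) ⊕ ((ι × Fin T) × η × Fin 3) → ℝ := fun h l =>
    match l with
    | Sum.inl (i, h') => if h i = h' then c else 0
    | Sum.inr _ => 0
  have hpos : ∀ x y k, hist x k = hist y k → pos x k = pos y k := fun x y k h => by
    simp only [pos, (G k.1).run_eq_of_history_eq k.2.2.le h k.2 le_rfl]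
  have hμ : ∀ h h', ∑ l, μ h l * μ h' l =
      (Fintype.card ι : ℝ)⁻¹ * ∑ i, if h i = h' i then 1 else 0 := fun h h' => by
    simp only [Fintype.sum_sum_type, Fintype.sum_prod_type (α₁ := ι), μ, mul_zero, ← hc,
      Finset.sum_const_zero, add_zero, Finset.mul_sum]
    refine Finset.sum_congr rfl fun i _ => ?_
    rw [Finset.sum_eq_single (h i) (fun j _ hj => by simp [hj.symm]) (by simp)]
    simp [eq_comm]
  have hμ1 : ∀ h, ∑ l, μ h l * μ h l = 1 := fun h => by simp [hμ, hcard]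
  obtain ⟨M, hM, hMx⟩ := QuantumQueryAlgorithm.exists_of_catalyst v (μ fun _ _ => none)
    (fun x => μ fun i => (G i).history T T x) hK (hμ1 _) (fun x => hμ1 _) (fun x y => by
      have h1 := sum_labelledAmplitude_mul (δ := ι × η) (pos x) (pos y) (hist x) (hist y) (f x) (f y)
        (hpos x y)
      have h2 := sum_labelledAmplitude_mul (δ := ι × η) (pos x) (pos y) (hist x) (hist y)
        (fun k q b e => f x k q (b - x q) e) (fun k q b e => f y k q (b - y q) e) (hpos x y)
      have h3 : ∀ x q b, v x q (b - x q) = labelledAmplitude (pos x) (hist x)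
          (fun k q b e => f x k q (b - x q) e) q b := fun x q b => by
        funext l
        rcases l with l | ⟨k, h, e⟩ <;> rfl
      have key : (∑ k, if hist x k = hist y k then
            (pos x k).elim 0 fun q => ∑ b, ∑ e, f x k q b e * f y k q b e else 0) -
          (∑ k, if hist x k = hist y k then
            (pos x k).elim 0 fun q => ∑ b, ∑ e, f x k q (b - x q) e * f y k q (b - y q) e else 0) =
          (Fintype.card ι : ℝ)⁻¹ *
            ∑ i, (1 - if (G i).history T T x = (G i).history T T y then 1 else 0) := by
        rw [← Finset.sum_sub_distrib, Fintype.sum_prod_type, Finset.mul_sum]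
        refine Finset.sum_congr rfl fun i _ => ?_
        have htel := Finset.sum_range_sub'
          (fun t => if (G i).history T t x = (G i).history T t y then (1 : ℝ) else 0) T
        rw [if_pos (by funext r; simp [history])] at htel
        rw [← htel, Finset.sum_range, Finset.mul_sum]
        refine Finset.sum_congr rfl fun t _ => ?_
        rw [← (G i).sum_nodeVector_sub_eq ha ha1 t.2 x y, ← hc]
        simp only [pos, hist, f, mul_mul_mul_comm c, ← Finset.mul_sum]
        cases (G i).pos ((G i).run x t) <;> split_ifs <;> simp [mul_sub]
      rw [Finset.sum_sub_distrib, mul_sub, Finset.sum_const, Finset.card_univ, nsmul_eq_mul,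
        mul_one, inv_mul_cancel₀ hcard] at key
      simp only [h3]
      rw [h2, h1, hμ]
      linarith) (fun l => match l with
      -- Any input with the history `h` leads to the same final state, so an arbitrary one decodes
      -- it. The remaining branches are defaults with zero amplitude.
      | Sum.inl (i, h) => if hx : ∃ x, (G i).history T T x = h then out i ((G i).run hx.choose T)
        else out (Classical.arbitrary ι) (G _).init
      | Sum.inr _ => out (Classical.arbitrary ι) (G _).init)
  refine ⟨M, hM, fun x P hP hx => hMx x P ?_ ?_⟩
  · rintro (⟨i, h⟩ | l) hl
    · have hh : (G i).history T T x = h := by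
        by_contra hne
        exact hl (if_neg hne)
      have hex : ∃ x, (G i).history T T x = h := ⟨x, hh⟩
      have hrun := (G i).run_eq_of_history_eq le_rfl (hex.choose_spec.trans hh.symm) T le_rfl
      simp only [dif_pos hex, hrun, hP]
    · exact absurd rfl hl
  · refine le_trans (le_of_eq ?_) hx
    rw [sum_labelledAmplitude_mul _ _ _ _ _ _ (hpos x x)]
    simp only [if_true, Fintype.sum_prod_type, Finset.mul_sum]
    refine Finset.sum_congr rfl fun i _ => ?_
    rw [Finset.sum_range]
    refine Finset.sum_congr rfl fun t _ => ?_
    simp only [pos, cost, f, mul_mul_mul_comm c, ← Finset.mul_sum, sum_nodeVector_self ha ha1, hc]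
    cases (G i).pos ((G i).run x t) <;> simp

end GuessingMachine

/-! ### Depth-first search and strong connectivity -/

section DepthFirst

variable {V : Type} [DecidableEq V] {E : V → V → Prop} {v₀ : V}

theorem edgeRel_mono {A A' : Finset (V × V)} (h : A ⊆ A') {u v : V}
    (huv : Relation.ReflTransGen (edgeRel A) u v) : Relation.ReflTransGen (edgeRel A') u v :=
  Relation.ReflTransGen.mono (fun _ _ he => h he) _ _ huv

/-- The properties of the states `(stack, S, A)` of a depth-first search from `v₀`. By the last one,
the vertices discovered while `z` is on the stack are descendants of `z`, and no edge from them
leads to a vertex discovered later. -/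
structure DfsInvariant (E : V → V → Prop) (v₀ : V) (stack S : List V) (A : Finset (V × V)) :
    Prop where
  nodup : S.Nodup
  root_mem : v₀ ∈ S
  stack_subset : ∀ u ∈ stack, u ∈ S
  reach : ∀ y ∈ S, Relation.ReflTransGen (edgeRel A) v₀ y
  edge_mem : ∀ e ∈ A, e.1 ∈ S ∧ e.2 ∈ S ∧ e.2 ≠ v₀
  edge_unique : ∀ e ∈ A, ∀ e' ∈ A, e.2 = e'.2 → e = e'
  sorted : stack.Pairwise fun a b => S.idxOf b < S.idxOf a
  descend : ∀ u ∈ stack, ∀ y ∈ S, S.idxOf u ≤ S.idxOf y → Relation.ReflTransGen (edgeRel A) u y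
  closed : ∀ w ∈ S, w ∉ stack → ∀ y, E w y → y ∈ S
  block : ∀ z ∈ S, z ∉ stack → ∃ P : Set V, z ∈ P ∧ ∀ w ∈ P,
    Relation.ReflTransGen (edgeRel A) z w ∧ ∀ y, E w y → y ∈ P ∨ S.idxOf y < S.idxOf z

theorem dfsInvariant_init : DfsInvariant E v₀ [v₀] [v₀] ∅ where
  nodup := List.nodup_singleton _
  root_mem := List.mem_singleton_self _
  stack_subset := fun _ h => h
  reach := fun y hy => by rw [List.mem_singleton.1 hy]
  edge_mem := by simp
  edge_unique := by simp
  sorted := List.pairwise_singleton _ _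
  descend := fun u hu y hy _ => by rw [List.mem_singleton.1 hy, List.mem_singleton.1 hu]
  closed := fun w hw hw' => absurd hw hw'
  block := fun w hw hw' => absurd hw hw'

theorem DfsInvariant.push {u v : V} {T S : List V} {A : Finset (V × V)}
    (h : DfsInvariant E v₀ (u :: T) S A) (hv : v ∉ S) :
    DfsInvariant E v₀ (v :: u :: T) (S ++ [v]) (insert (u, v) A) := by
  -- Numbers of discovered vertices never change, which is why the invariants persist.
  have hidx : ∀ y ∈ S, (S ++ [v]).idxOf y = S.idxOf y := fun y hy =>
    List.idxOf_append_of_mem hy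
  have hidxv : (S ++ [v]).idxOf v = S.length := by
    rw [List.idxOf_append_of_notMem hv]; simp
  have hlt : ∀ y ∈ S, S.idxOf y < S.length := fun y hy => List.idxOf_lt_length_iff.2 hy
  have hu : u ∈ S := h.stack_subset u (by simp)
  have hA : A ⊆ insert (u, v) A := Finset.subset_insert _ _
  have huv : edgeRel (insert (u, v) A) u v := Finset.mem_insert_self _ _
  have hne : ∀ y ∈ S, y ≠ v := fun y hy e => hv (e ▸ hy)
  have hmem : ∀ y, y ∈ S ++ [v] ↔ y ∈ S ∨ y = v := by simp
  constructor
  · exact h.nodup.append (List.nodup_singleton v) (by simpa using hv)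
  · exact (hmem _).2 (Or.inl h.root_mem)
  · intro y hy
    rcases List.mem_cons.1 hy with rfl | hy
    · simp
    · exact (hmem _).2 (Or.inl (h.stack_subset y hy))
  · intro y hy
    rcases (hmem y).1 hy with hy | rfl
    · exact edgeRel_mono hA (h.reach y hy)
    · exact (edgeRel_mono hA (h.reach u hu)).tail huv
  · intro e he
    rcases Finset.mem_insert.1 he with rfl | he
    · exact ⟨(hmem _).2 (Or.inl hu), (hmem _).2 (Or.inr rfl), (hne v₀ h.root_mem).symm⟩
    · obtain ⟨h1, h2, h3⟩ := h.edge_mem e he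
      exact ⟨(hmem _).2 (Or.inl h1), (hmem _).2 (Or.inl h2), h3⟩
  · intro e he e' he' hee
    rcases Finset.mem_insert.1 he with rfl | he <;> rcases Finset.mem_insert.1 he' with rfl | he'
    · rfl
    · exact absurd hee.symm (hne _ (h.edge_mem e' he').2.1)
    · exact absurd hee (hne _ (h.edge_mem e he).2.1)
    · exact h.edge_unique e he e' he' hee
  · refine List.pairwise_cons.2 ⟨fun y hy => ?_, h.sorted.imp_of_mem fun ha hb hab => ?_⟩
    · rw [hidx y (h.stack_subset y hy), hidxv]
      exact hlt y (h.stack_subset y hy)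
    · rwa [hidx _ (h.stack_subset _ ha), hidx _ (h.stack_subset _ hb)]
  · intro a ha y hy hay
    rcases List.mem_cons.1 ha with rfl | ha'
    · rcases (hmem y).1 hy with hy | rfl
      · rw [hidxv, hidx y hy] at hay
        exact absurd hay (not_le.2 (hlt y hy))
      · exact .refl
    · have haS := h.stack_subset a ha'
      rcases (hmem y).1 hy with hy | rfl
      · rw [hidx a haS, hidx y hy] at hay
        exact edgeRel_mono hA (h.descend a ha' y hy hay)
      · refine (edgeRel_mono hA (h.descend a ha' u hu ?_)).tail huv
        rcases List.mem_cons.1 ha' with rfl | ha''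
        · exact le_rfl
        · exact ((List.pairwise_cons.1 h.sorted).1 a ha'').le
  · intro w hw hw' y hy
    rcases (hmem w).1 hw with hw | rfl
    · exact (hmem _).2 (Or.inl (h.closed w hw (fun h => hw' (List.mem_cons_of_mem _ h)) y hy))
    · exact absurd (List.mem_cons_self) hw'
  · intro z hz hz'
    rcases (hmem z).1 hz with hz | rfl
    · obtain ⟨P, hzP, hP⟩ := h.block z hz fun h => hz' (List.mem_cons_of_mem _ h)
      refine ⟨P, hzP, fun w hw => ⟨edgeRel_mono hA (hP w hw).1, fun y hy => ?_⟩⟩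
      refine ((hP w hw).2 y hy).imp_right fun hlt' => ?_
      have hyS : y ∈ S := List.idxOf_lt_length_iff.1 (hlt'.trans (hlt z hz))
      rwa [hidx y hyS, hidx z hz]
    · exact absurd (List.mem_cons_self) hz'

theorem DfsInvariant.pop {u : V} {T S : List V} {A : Finset (V × V)}
    (h : DfsInvariant E v₀ (u :: T) S A) (hu : ∀ v, E u v → v ∈ S) :
    DfsInvariant E v₀ T S A := by
  have hsort := List.pairwise_cons.1 h.sorted
  have hclosed : ∀ w ∈ S, w ∉ T → ∀ y, E w y → y ∈ S := fun w hw hwT y hy => by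
    by_cases hwu : w = u
    · exact hu y (hwu ▸ hy)
    · exact h.closed w hw (by simp [hwu, hwT]) y hy
  refine ⟨h.nodup, h.root_mem, fun y hy => h.stack_subset y (List.mem_cons_of_mem _ hy), h.reach,
    h.edge_mem, h.edge_unique, hsort.2, fun a ha => h.descend a (List.mem_cons_of_mem _ ha),
    hclosed, fun z hz hzT => ?_⟩
  by_cases hzu : z = u
  · subst hzu
    -- When `z` is popped, the block consists of the vertices discovered since `z`. They are
    -- descendants of `z`, and as none is below `z` on the stack, all their out-neighbours have been
    -- discovered.
    refine ⟨{y | y ∈ S ∧ S.idxOf z ≤ S.idxOf y}, ⟨hz, le_rfl⟩, fun w hw =>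
      ⟨h.descend z List.mem_cons_self w hw.1 hw.2, fun y hy => ?_⟩⟩
    have hyS := hclosed w hw.1 (fun hwT => absurd (hsort.1 w hwT) (not_lt.2 hw.2)) y hy
    exact (le_or_gt (S.idxOf z) (S.idxOf y)).imp_left fun hle => ⟨hyS, hle⟩
  · exact h.block z hz (by simp [hzu, hzT])

theorem dfsInvariant_of_reflTransGen {s : List V × List V × Finset (V × V)}
    (h : Relation.ReflTransGen (DfsStep E) ([v₀], [v₀], ∅) s) :
    DfsInvariant E v₀ s.1 s.2.1 s.2.2 := by
  induction h with
  | refl => exact dfsInvariant_init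
  | tail _ hstep ih =>
    cases hstep with
    | push u v T S A huv hv => exact ih.push hv
    | pop u T S A hu => exact ih.pop hu

theorem IsDepthFirst.isTreeRootedAt {S : List V} {A : Finset (V × V)}
    (h : IsDepthFirst E v₀ S A) : IsTreeRootedAt v₀ A := by
  have hI := dfsInvariant_of_reflTransGen h
  exact ⟨fun e he => (hI.edge_mem e he).2.2, hI.edge_unique,
    fun e he => hI.reach _ (hI.edge_mem e he).1⟩

theorem IsSmallestNeighbourSet.exists_mem {S : List V} {B : Finset (V × V)}
    (h : IsSmallestNeighbourSet E S B) {u y : V} (hu : u ∈ S) (hy : E u y) :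
    ∃ w, (u, w) ∈ B ∧ S.idxOf w ≤ S.idxOf y := by
  obtain ⟨w, hw, hmin⟩ := (measure fun v => S.idxOf v).wf.has_min {v | E u v} ⟨y, hy⟩
  have hmin' : ∀ x, E u x → S.idxOf w ≤ S.idxOf x := fun x hx => not_lt.1 (hmin x hx)
  exact ⟨w, (h u w).2 ⟨hu, hw, hmin'⟩, hmin' y hy⟩

/-- The tree reaches every vertex from `v₀`, so it remains to return to `v₀`. From `u`, take the
reachable vertex `z` of smallest number; its block has no outgoing edge, so it contains `v₀`. -/
theorem IsDfsWithSmallestNeighbours.stronglyConnected {A B : Finset (V × V)}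
    (h : IsDfsWithSmallestNeighbours E v₀ A B) (hE : StronglyConnected E) :
    StronglyConnected (edgeRel (A ∪ B)) := by
  obtain ⟨S, hS, hB⟩ := h
  have hI := dfsInvariant_of_reflTransGen hS
  have hall : ∀ v, v ∈ S := fun v => by
    induction hE v₀ v with
    | refl => exact hI.root_mem
    | tail _ hvw ih => exact hI.closed _ ih List.not_mem_nil _ hvw
  have hA : A ⊆ A ∪ B := Finset.subset_union_left
  have hroot : ∀ u, Relation.ReflTransGen (edgeRel (A ∪ B)) u v₀ := fun u => by
    obtain ⟨z, hz, hmin⟩ := (measure fun v => S.idxOf v).wf.has_min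
      {v | Relation.ReflTransGen (edgeRel (A ∪ B)) u v} ⟨u, .refl⟩
    obtain ⟨P, hzP, hP⟩ := hI.block z (hall z) List.not_mem_nil
    have hPall : ∀ v, v ∈ P := fun v => by
      induction hE z v with
      | refl => exact hzP
      | @tail w y _ hwy ih =>
        refine ((hP w ih).2 y hwy).resolve_right fun hlt => ?_
        obtain ⟨y', hy', hle⟩ := hB.exists_mem (hall w) hwy
        refine hmin y' ?_ (hle.trans_lt hlt)
        exact (Relation.ReflTransGen.trans hz (edgeRel_mono hA (hP w ih).1)).tail
          (Finset.mem_union_right _ hy')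
    exact Relation.ReflTransGen.trans hz (edgeRel_mono hA (hP v₀ (hPall v₀)).1)
  exact fun u v => (hroot u).trans (edgeRel_mono hA (hI.reach v (hall v)))

theorem StronglyConnected.mono {E' : V → V → Prop} (h : StronglyConnected E)
    (hE : ∀ u v, E u v → E' u v) : StronglyConnected E' :=
  fun u v => Relation.ReflTransGen.mono hE _ _ (h u v)

end DepthFirst

/-! ### Ranks and random orders -/

/-- Distinct keys have distinct ranks between `1` and `D`. -/
theorem sum_inv_rank_le_harmonic {D : ℕ} (key : Fin D → ℕ) (hkey : Function.Injective key) :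
    ∑ j, ((Finset.univ.filter fun j' => key j' ≤ key j).card : ℝ)⁻¹ ≤ (harmonic D : ℝ) := by
  set r : Fin D → ℕ := fun j => (Finset.univ.filter fun j' => key j' ≤ key j).card with hr
  have hlt : ∀ i j, key i < key j → r i < r j := fun i j hij => by
    refine Finset.card_lt_card (Finset.ssubset_iff_of_subset (fun a ha => ?_) |>.2 ⟨j, ?_, ?_⟩)
    · simp only [Finset.mem_filter, Finset.mem_univ, true_and] at ha ⊢
      omega
    · simp
    · simpa using hij
  have hinj : Function.Injective r := fun i j hij => by
    rcases lt_trichotomy (key i) (key j) with h | h | h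
    · exact absurd hij (hlt i j h).ne
    · exact hkey h
    · exact absurd hij (hlt j i h).ne'
  rw [harmonic_eq_sum_Icc]
  push_cast
  calc ∑ j, (r j : ℝ)⁻¹ = ∑ i ∈ Finset.univ.image r, (i : ℝ)⁻¹ := by
        rw [Finset.sum_image hinj.injOn]
    _ ≤ _ := by
        refine Finset.sum_le_sum_of_subset_of_nonneg (fun i hi => ?_) fun i _ _ => by positivity
        obtain ⟨j, -, rfl⟩ := Finset.mem_image.1 hi
        refine Finset.mem_Icc.2 ⟨Finset.card_pos.2 ⟨j, by simp⟩, ?_⟩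
        exact (Finset.card_le_univ _).trans_eq (Fintype.card_fin D)

/-- By symmetry, composing with a transposition, each element of `L` is first equally often, and the
orders with different first elements are different. -/
theorem card_mul_card_first_le {Q : Type} [Fintype Q] [DecidableEq Q] {m : ℕ} (L : Finset Q)
    {q : Q} (hq : q ∈ L) :
    L.card * (Finset.univ.filter fun σ : Q ≃ Fin m => ∀ q' ∈ L, σ q ≤ σ q').card ≤
      Fintype.card (Q ≃ Fin m) := by
  let F : Q → Finset (Q ≃ Fin m) := fun e => Finset.univ.filter fun σ => ∀ q' ∈ L, σ e ≤ σ q'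
  have hcard : ∀ e ∈ L, (F q).card ≤ (F e).card := fun e he => by
    refine Finset.card_le_card_of_injOn (fun σ => (Equiv.swap q e).trans σ) (fun σ hσ => ?_)
      (fun σ _ σ' _ h => ?_)
    · simp only [F, Finset.coe_filter, Finset.mem_univ, true_and, Set.mem_ofPred_eq] at hσ ⊢
      intro q' hq'
      simp only [Equiv.trans_apply, Equiv.swap_apply_right]
      refine hσ _ ?_
      rw [Equiv.swap_apply_def]
      split_ifs <;> assumption
    · exact Equiv.ext fun a => by
        simpa using Equiv.congr_fun h (Equiv.swap q e a)
  have hdisj : (L : Set Q).PairwiseDisjoint F := fun e he e' he' hne => by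
    refine Finset.disjoint_left.2 fun σ h h' => hne ?_
    simp only [F, Finset.mem_filter, Finset.mem_univ, true_and] at h h'
    exact σ.injective (le_antisymm (h e' he') (h' e he))
  calc L.card * (F q).card = ∑ e ∈ L, (F q).card := by simp
    _ ≤ ∑ e ∈ L, (F e).card := Finset.sum_le_sum hcard
    _ = (L.biUnion F).card := (Finset.card_biUnion hdisj).symm
    _ ≤ _ := Finset.card_le_univ _

/-! ### The search machine and its correctness -/

/-- The positions of the arrays with the lengths `d`. -/
abbrev Position {n : ℕ} (d : Fin n → ℕ) : Type := (i : Fin n) × Fin (d i)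

/-- A state of a depth-first search: the stack, the number of scanned entries of each array, the
visited vertices in the order of their discovery, and the positions of the tree edges. -/
structure SearchState {n : ℕ} (d : Fin n → ℕ) where
  stack : List (Fin n)
  scanned : Fin n → ℕ
  visited : List (Fin n)
  tree : Finset (Position d)

/-- A state of a scan of all arrays: the number of positions that have been scanned, and for each
vertex the best out-neighbour found so far, with its position. -/
structure ScanState {n : ℕ} (d : Fin n → ℕ) where
  count : ℕ
  best : Fin n → Option (Position d × Fin n)

section

variable {n : ℕ} {d : Fin n → ℕ}

/-- The position scanned next by a depth-first search. -/
def SearchState.pos (D : SearchState d) : Option (Position d) :=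
  match D.stack with
  | [] => none
  | u :: _ => if h : D.scanned u < d u then some ⟨u, D.scanned u, h⟩ else none

/-- A step of a depth-first search; `r` is the scanned vertex if it has not been visited before. -/
def SearchState.next (D : SearchState d) (r : Option (Fin n)) : SearchState d :=
  match D.stack with
  | [] => D
  | u :: T =>
    if h : D.scanned u < d u then
      match r with
      | none => { D with scanned := Function.update D.scanned u (D.scanned u + 1) }
      | some w =>
        { stack := w :: u :: T
          scanned := Function.update D.scanned u (D.scanned u + 1)
          visited := D.visited ++ [w]
          tree := insert ⟨u, D.scanned u, h⟩ D.tree }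
    else { D with stack := T }

/-- A step of the depth-first search in the graph `f`. -/
def SearchState.advance (f : ArrayGraph n d) (D : SearchState d) : SearchState d :=
  D.next (D.pos.bind fun q => if f.entry q ∈ D.visited then none else some (f.entry q))

/-- The initial state of a depth-first search. -/
def SearchState.init (d : Fin n → ℕ) (v₀ : Fin n) : SearchState d :=
  { stack := [v₀], scanned := fun _ => 0, visited := [v₀], tree := ∅ }

variable (σ : Position d ≃ Fin (∑ i, d i))

/-- The position scanned next, in the order `σ`. -/
def ScanState.pos (R : ScanState d) : Option (Position d) :=
  if h : R.count < ∑ i, d i then some (σ.symm ⟨R.count, h⟩) else none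

/-- A step of the scan; `r` is the scanned vertex if it improves on the best one so far. -/
def ScanState.next (R : ScanState d) (r : Option (Fin n)) : ScanState d :=
  match R.pos σ with
  | none => R
  | some q =>
    { count := R.count + 1
      best := match r with
        | none => R.best
        | some w => Function.update R.best q.1 (some (q, w)) }

/-- Scanning the position `q` with the entry `w` does not improve on the best out-neighbour of
a vertex of the list `S`. -/
def ScanState.IsUseless (R : ScanState d) (S : List (Fin n)) (q : Position d) (w : Fin n) : Prop :=
  q.1 ∈ S → ∃ p, R.best q.1 = some p ∧ S.idxOf p.2 ≤ S.idxOf w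

/-- A depth-first search from `v₀`, which predicts that the scanned vertices have been visited
before, followed by a scan for the out-neighbours that have been discovered first, which predicts
that the scanned vertices are no improvement. -/
def searchMachine (v₀ : Fin n) : GuessingMachine (Position d) n where
  State := SearchState d × ScanState d
  init := (SearchState.init d v₀, { count := 0, best := fun _ => none })
  pos s := match s.1.stack with
    | [] => s.2.pos σ
    | _ :: _ => s.1.pos
  predicted s w := match s.1.stack with
    | [] => ∀ q, s.2.pos σ = some q → s.2.IsUseless s.1.visited q w
    | _ :: _ => w ∈ s.1.visited
  next s r := match s.1.stack with
    | [] => (s.1, s.2.next σ r)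
    | _ :: _ => (s.1.next r, s.2)

variable (f : ArrayGraph n d)

/-- The steps of the machine in the graph `f`, with the numbers of queries and of surprises. -/
inductive SearchStep : SearchState d × ScanState d → SearchState d × ScanState d → ℕ → ℕ → Prop
  | done (c S P k b) (hk : ∑ i, d i ≤ k) :
      SearchStep (⟨[], c, S, P⟩, ⟨k, b⟩) (⟨[], c, S, P⟩, ⟨k, b⟩) 0 0
  | skip (c S P k b) (hk : k < ∑ i, d i)
      (h : ScanState.IsUseless ⟨k, b⟩ S (σ.symm ⟨k, hk⟩) (f.entry (σ.symm ⟨k, hk⟩))) :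
      SearchStep (⟨[], c, S, P⟩, ⟨k, b⟩) (⟨[], c, S, P⟩, ⟨k + 1, b⟩) 1 0
  | improve (c S P k b) (hk : k < ∑ i, d i)
      (h : ¬ ScanState.IsUseless ⟨k, b⟩ S (σ.symm ⟨k, hk⟩) (f.entry (σ.symm ⟨k, hk⟩))) :
      SearchStep (⟨[], c, S, P⟩, ⟨k, b⟩) (⟨[], c, S, P⟩, ⟨k + 1, Function.update b
        (σ.symm ⟨k, hk⟩).1 (some (σ.symm ⟨k, hk⟩, f.entry (σ.symm ⟨k, hk⟩)))⟩) 1 1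
  | known (u T c S P R) (hc : c u < d u) (h : f u ⟨c u, hc⟩ ∈ S) :
      SearchStep (⟨u :: T, c, S, P⟩, R) (⟨u :: T, Function.update c u (c u + 1), S, P⟩, R) 1 0
  | push (u T c S P R) (hc : c u < d u) (h : f u ⟨c u, hc⟩ ∉ S) :
      SearchStep (⟨u :: T, c, S, P⟩, R) (⟨f u ⟨c u, hc⟩ :: u :: T, Function.update c u (c u + 1),
        S ++ [f u ⟨c u, hc⟩], insert ⟨u, c u, hc⟩ P⟩, R) 1 1
  | pop (u T c S P R) (hc : d u ≤ c u) : SearchStep (⟨u :: T, c, S, P⟩, R) (⟨T, c, S, P⟩, R) 0 0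

theorem searchStep_next (v₀ : Fin n) (s : SearchState d × ScanState d) :
    SearchStep σ f s ((searchMachine σ v₀).next s ((searchMachine σ v₀).surprise f.entry s))
      (if ((searchMachine σ v₀).pos s).isSome then 1 else 0)
      (if ((searchMachine σ v₀).surprise f.entry s).isSome then 1 else 0) := by
  obtain ⟨⟨_ | ⟨u, T⟩, c, S, P⟩, k, b⟩ := s
  · by_cases hk : k < ∑ i, d i
    · by_cases h : ScanState.IsUseless ⟨k, b⟩ S (σ.symm ⟨k, hk⟩) (f.entry (σ.symm ⟨k, hk⟩))
      · have := SearchStep.skip (σ := σ) (f := f) c S P k b hk h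
        simpa [searchMachine, GuessingMachine.surprise, ScanState.pos, ScanState.next, hk, h]
      · have := SearchStep.improve (σ := σ) (f := f) c S P k b hk h
        simpa [searchMachine, GuessingMachine.surprise, ScanState.pos, ScanState.next, hk, h]
    · have := SearchStep.done (σ := σ) (f := f) c S P k b (not_lt.1 hk)
      simpa [searchMachine, GuessingMachine.surprise, ScanState.pos, ScanState.next, hk]
  · by_cases hc : c u < d u
    · by_cases h : f u ⟨c u, hc⟩ ∈ S
      · have := SearchStep.known (σ := σ) (f := f) u T c S P ⟨k, b⟩ hc h
        simpa [searchMachine, GuessingMachine.surprise, SearchState.pos, SearchState.next, hc,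
          ArrayGraph.entry, h]
      · have := SearchStep.push (σ := σ) (f := f) u T c S P ⟨k, b⟩ hc h
        simpa [searchMachine, GuessingMachine.surprise, SearchState.pos, SearchState.next, hc,
          ArrayGraph.entry, h]
    · have := SearchStep.pop (σ := σ) (f := f) u T c S P ⟨k, b⟩ (not_lt.1 hc)
      simpa [searchMachine, GuessingMachine.surprise, SearchState.pos, SearchState.next, hc]

/-- The search does not depend on `σ`. Hence the discovery order is fixed before the random order
enters the count of records. -/
theorem SearchStep.fst_eq {s s' : SearchState d × ScanState d} {a b : ℕ}
    (h : SearchStep σ f s s' a b) : s'.1 = s.1.advance f := by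
  cases h with
  | done | skip | improve => rfl
  | known u T c S P R hc h =>
    simp [SearchState.advance, SearchState.next, SearchState.pos, hc, ArrayGraph.entry, h]
  | push u T c S P R hc h =>
    simp [SearchState.advance, SearchState.next, SearchState.pos, hc, ArrayGraph.entry, h]
  | pop u T c S P R hc =>
    simp [SearchState.advance, SearchState.next, not_lt.2 hc]

/-- The edges of `f` at the positions `P`. -/
def ArrayGraph.edges (P : Finset (Position d)) : Finset (Fin n × Fin n) :=
  P.image fun q => (q.1, f.entry q)

/-- The properties of the states of the machine. -/
structure SearchInvariant (v₀ : Fin n) (D : SearchState d) (R : ScanState d) : Prop where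
  dfs : Relation.ReflTransGen (DfsStep f.Edge) ([v₀], [v₀], ∅) (D.stack, D.visited, f.edges D.tree)
  scanned_le : ∀ u, D.scanned u ≤ d u
  scanned_mem : ∀ u (j : Fin (d u)), j < D.scanned u → f u j ∈ D.visited
  card_tree : D.tree.card < D.visited.length
  count_eq : D.stack ≠ [] → R.count = 0
  count_le : R.count ≤ ∑ i, d i
  best_spec : ∀ u q w, R.best u = some (q, w) →
    u ∈ D.visited ∧ q.1 = u ∧ f.entry q = w ∧ σ q < R.count
  best_le : ∀ q, q.1 ∈ D.visited → σ q < R.count →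
    ∃ p, R.best q.1 = some p ∧ D.visited.idxOf p.2 ≤ D.visited.idxOf (f.entry q)

theorem searchInvariant_init (v₀ : Fin n) :
    SearchInvariant σ f v₀ (SearchState.init d v₀) { count := 0, best := fun _ => none } := by
  constructor <;> simp [SearchState.init, ArrayGraph.edges, Relation.ReflTransGen.refl]

variable {σ f}

theorem mem_of_lt_update_succ {c : Fin n → ℕ} {u : Fin n} (hc : c u < d u) {S S' : List (Fin n)}
    (h : ∀ v (j : Fin (d v)), j < c v → f v j ∈ S) (hS : S ⊆ S') (hu : f u ⟨c u, hc⟩ ∈ S') (v : Fin n)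
    (j : Fin (d v)) (hj : j < Function.update c u (c u + 1) v) : f v j ∈ S' := by
  by_cases hv : v = u
  · subst hv
    rw [Function.update_self] at hj
    rcases Nat.lt_succ_iff_lt_or_eq.1 hj with hj | hj
    · exact hS (h v j hj)
    · have : j = ⟨c v, hc⟩ := Fin.ext hj
      rwa [this]
  · rw [Function.update_of_ne hv] at hj
    exact hS (h v j hj)

theorem update_succ_le {c : Fin n → ℕ} {u : Fin n} (hc : c u < d u) (h : ∀ v, c v ≤ d v)
    (v : Fin n) : Function.update c u (c u + 1) v ≤ d v := by
  by_cases hv : v = u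
  · subst hv
    rwa [Function.update_self]
  · rw [Function.update_of_ne hv]
    exact h v

theorem SearchInvariant.step {v₀ : Fin n} {s s' : SearchState d × ScanState d} {a b : ℕ}
    (hs : SearchStep σ f s s' a b) (h : SearchInvariant σ f v₀ s.1 s.2) :
    SearchInvariant σ f v₀ s'.1 s'.2 := by
  cases hs with
  | done => exact h
  | skip c S P k b hk hu =>
    refine ⟨h.dfs, h.scanned_le, h.scanned_mem, h.card_tree, fun h => absurd rfl h, hk,
      fun u q w hq => ?_, fun q hq hσ => ?_⟩
    · obtain ⟨h1, h2, h3, h4⟩ := h.best_spec u q w hq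
      exact ⟨h1, h2, h3, Nat.lt_succ_of_lt h4⟩
    · rcases Nat.lt_succ_iff_lt_or_eq.1 hσ with hσ | hσ
      · exact h.best_le q hq hσ
      · have hq' : q = σ.symm ⟨k, hk⟩ := by
          rw [Equiv.eq_symm_apply]; exact Fin.ext hσ
        subst hq'
        exact hu hq
  | improve c S P k b hk hu =>
    have hσk : σ (σ.symm ⟨k, hk⟩) = ⟨k, hk⟩ := σ.apply_symm_apply _
    generalize σ.symm ⟨k, hk⟩ = q₀ at *
    simp only [ScanState.IsUseless, Classical.not_imp, not_exists, not_and, not_le] at hu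
    refine ⟨h.dfs, h.scanned_le, h.scanned_mem, h.card_tree, fun h => absurd rfl h, hk,
      fun u q w hq => ?_, fun q hq hσ => ?_⟩
    · by_cases hu' : u = q₀.1
      · subst hu'
        simp only [Function.update_self, Option.some.injEq, Prod.mk.injEq] at hq
        obtain ⟨rfl, rfl⟩ := hq
        exact ⟨hu.1, rfl, rfl, by simp [hσk]⟩
      · simp only [Function.update_of_ne hu'] at hq
        obtain ⟨h1, h2, h3, h4⟩ := h.best_spec u q w hq
        exact ⟨h1, h2, h3, Nat.lt_succ_of_lt h4⟩
    · rcases Nat.lt_succ_iff_lt_or_eq.1 hσ with hσ | hσ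
      · obtain ⟨p, hp, hle⟩ := h.best_le q hq hσ
        by_cases hq' : q.1 = q₀.1
        · refine ⟨(q₀, f.entry q₀), by simp [hq'], ?_⟩
          rw [hq'] at hp
          exact (hu.2 p hp).le.trans hle
        · exact ⟨p, (Function.update_of_ne hq' _ _).trans hp, hle⟩
      · have hq' : q = q₀ := σ.injective (by rw [hσk]; exact Fin.ext hσ)
        subst hq'
        exact ⟨(q, f.entry q), by simp, le_rfl⟩
  | known u T c S P R hc hmem =>
    have hR : R.count = 0 := h.count_eq (List.cons_ne_nil u T)
    exact ⟨h.dfs, update_succ_le hc h.scanned_le,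
      mem_of_lt_update_succ hc h.scanned_mem (List.Subset.refl _) hmem, h.card_tree, fun _ => hR,
      h.count_le, h.best_spec, h.best_le⟩
  | push u T c S P R hc hmem =>
    have hR : R.count = 0 := h.count_eq (List.cons_ne_nil u T)
    refine ⟨?_, update_succ_le hc h.scanned_le,
      mem_of_lt_update_succ hc h.scanned_mem (List.subset_append_left _ _) (by simp), ?_,
      fun _ => hR, h.count_le, fun u q w hq => ?_, fun q hq hσ => ?_⟩
    · have := h.dfs.tail (DfsStep.push u (f u ⟨c u, hc⟩) T S (f.edges P) ⟨_, rfl⟩ hmem)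
      simpa [ArrayGraph.edges, Finset.image_insert, ArrayGraph.entry] using this
    · have h1 := h.card_tree
      have h2 := Finset.card_insert_le (⟨u, c u, hc⟩ : Position d) P
      simp only [List.length_append, List.length_singleton] at h1 ⊢
      omega
    · exact absurd (h.best_spec u q w hq).2.2.2 (by simp [hR])
    · exact absurd hσ (by simp [hR])
  | pop u T c S P R hc =>
    have hR : R.count = 0 := h.count_eq (List.cons_ne_nil u T)
    refine ⟨h.dfs.tail (DfsStep.pop u T S _ ?_), h.scanned_le, h.scanned_mem, h.card_tree,
      fun _ => hR, h.count_le, h.best_spec, h.best_le⟩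
    rintro v ⟨j, rfl⟩
    exact h.scanned_mem u j (j.2.trans_le hc)

/-- The positions of the best out-neighbours. -/
def ScanState.bestPositions (R : ScanState d) : Finset (Position d) :=
  Finset.univ.filter fun q => ∃ w, R.best q.1 = some (q, w)

theorem ScanState.card_bestPositions_le (R : ScanState d) : R.bestPositions.card ≤ n := by
  refine (Finset.card_le_card_of_injOn Sigma.fst (t := Finset.univ) (by simp) ?_).trans
    (by simp)
  intro q hq q' hq' h
  obtain ⟨w, hw⟩ := (Finset.mem_filter.1 hq).2
  obtain ⟨w', hw'⟩ := (Finset.mem_filter.1 hq').2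
  rw [← h, hw] at hw'
  simp only [Option.some.injEq, Prod.mk.injEq] at hw'
  exact hw'.1

/-- Once every position is scanned, `best_le` compares the stored out-neighbour with all others;
ties are excluded because distinct discovered vertices have distinct numbers. -/
theorem SearchInvariant.isDfsWithSmallestNeighbours {v₀ : Fin n} {D : SearchState d}
    {R : ScanState d} (h : SearchInvariant σ f v₀ D R) (hD : D.stack = [])
    (hR : R.count = ∑ i, d i) :
    IsDfsWithSmallestNeighbours f.Edge v₀ (f.edges D.tree) (f.edges R.bestPositions) := by
  have hdfs := h.dfs
  rw [hD] at hdfs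
  have hI := dfsInvariant_of_reflTransGen hdfs
  have hlt : ∀ q, (σ q).val < R.count := fun q => by rw [hR]; exact (σ q).2
  refine ⟨D.visited, hdfs, fun u w => ⟨fun huw => ?_, fun ⟨hu, ⟨j, hj⟩, hmin⟩ => ?_⟩⟩
  · obtain ⟨q, hq, hqe⟩ := Finset.mem_image.1 huw
    simp only [Prod.mk.injEq] at hqe
    obtain ⟨rfl, rfl⟩ := hqe
    obtain ⟨w, hw⟩ := (Finset.mem_filter.1 hq).2
    obtain ⟨h1, -, rfl, -⟩ := h.best_spec _ _ _ hw
    refine ⟨h1, ⟨q.2, rfl⟩, ?_⟩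
    rintro y ⟨j, rfl⟩
    obtain ⟨p, hp, hle⟩ := h.best_le ⟨q.1, j⟩ h1 (hlt _)
    rw [hw, Option.some.injEq] at hp
    rw [← hp] at hle
    exact hle
  · obtain ⟨⟨q, w'⟩, hp, hle⟩ := h.best_le ⟨u, j⟩ hu (hlt _)
    obtain ⟨-, rfl, rfl, -⟩ := h.best_spec _ _ _ hp
    have hw : w ∈ D.visited := hI.closed _ hu List.not_mem_nil w ⟨j, hj⟩
    have hle' : D.visited.idxOf (f.entry q) ≤ D.visited.idxOf w := by rw [← hj]; exact hle
    have heq := le_antisymm (hmin (f.entry q) ⟨q.2, rfl⟩) hle'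
    have hw' : w = f.entry q := (List.idxOf_inj hw).1 heq
    rw [hw']
    exact Finset.mem_image.2 ⟨q, Finset.mem_filter.2 ⟨Finset.mem_univ _, _, hp⟩, rfl⟩

end

/-! ### Counting queries, surprises and records -/

theorem Finset.sum_update_succ {ι : Type} [Fintype ι] [DecidableEq ι] (c : ι → ℕ) (u : ι) :
    ∑ i, Function.update c u (c u + 1) i = ∑ i, c i + 1 := by
  rw [Finset.sum_update_of_mem (Finset.mem_univ u), ← Finset.add_sum_erase _ c (Finset.mem_univ u),
    Finset.sdiff_singleton_eq_erase]
  omega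

namespace GuessingMachine

variable {Q : Type} {n : ℕ} (G : GuessingMachine Q n)

/-- The number of queries in the first `t` steps. -/
noncomputable def queryCount (x : Q → Fin n) (t : ℕ) : ℕ :=
  ∑ r ∈ Finset.range t, if (G.pos (G.run x r)).isSome then 1 else 0

/-- The number of wrong predictions in the first `t` steps. -/
noncomputable def surpriseCount (x : Q → Fin n) (t : ℕ) : ℕ :=
  ∑ r ∈ Finset.range t, if (G.surprise x (G.run x r)).isSome then 1 else 0

theorem sum_cost_le {a : ℝ} (ha : 0 < a) (x : Q → Fin n) (t : ℕ) :
    ∑ r ∈ Finset.range t, G.cost a x (G.run x r) ≤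
      2 * a * G.queryCount x t + 2 * a⁻¹ * G.surpriseCount x t := by
  have ha' : 0 < a⁻¹ := inv_pos.2 ha
  simp only [queryCount, surpriseCount, Nat.cast_sum, Finset.mul_sum, ← Finset.sum_add_distrib]
  refine Finset.sum_le_sum fun r _ => ?_
  simp only [cost, surprise]
  obtain hp | ⟨q, hp⟩ := Option.eq_none_or_eq_some (G.pos (G.run x r))
  · simp [hp]
  · by_cases h : G.predicted (G.run x r) (x q)
    · simp [h, hp]
    · simp only [h, hp, Option.elim_some, if_false, Option.isSome_some, if_true, Nat.cast_one]
      linarith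

theorem sum_cost_one_le (x : Q → Fin n) (t : ℕ) :
    ∑ r ∈ Finset.range t, G.cost 1 x (G.run x r) ≤ 2 * G.queryCount x t := by
  simp only [queryCount, Nat.cast_sum, Finset.mul_sum]
  refine Finset.sum_le_sum fun r _ => ?_
  simp only [cost]
  obtain hp | ⟨q, hp⟩ := Option.eq_none_or_eq_some (G.pos (G.run x r))
  · simp [hp]
  · by_cases h : G.predicted (G.run x r) (x q)
    · simp [h, hp]
    · simp only [h, hp, Option.elim_some, if_false, Option.isSome_some, if_true]
      norm_num

end GuessingMachine

section

variable {n : ℕ} {d : Fin n → ℕ} (σ : Position d ≃ Fin (∑ i, d i)) (f : ArrayGraph n d)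

/-- At the position `q` there is an out-neighbour that comes in the list `S` before all
out-neighbours of the same vertex at the positions before `q` in the order `σ`. -/
def IsRecord (S : List (Fin n)) (q : Position d) : Prop :=
  q.1 ∈ S ∧ ∀ q' : Position d, q'.1 = q.1 → σ q' < σ q →
    S.idxOf (f.entry q) < S.idxOf (f.entry q')

open Classical in
/-- The records among the first `k` positions in the order `σ`. -/
noncomputable def records (S : List (Fin n)) (k : ℕ) : Finset (Position d) :=
  Finset.univ.filter fun q => (σ q).val < k ∧ IsRecord σ f S q

variable {σ f}

theorem SearchStep.sum_scanned_add_count {s s' : SearchState d × ScanState d} {a b : ℕ}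
    (hs : SearchStep σ f s s' a b) :
    ∑ i, s.1.scanned i + s.2.count + a = ∑ i, s'.1.scanned i + s'.2.count := by
  cases hs <;> simp only [Finset.sum_update_succ] <;> omega

/-- A potential that pays for the surprises: a push lengthens the visited list, and an improvement
is a record because the stored vertex is at least as early as all those scanned before. During the
search the count is `0`, so there are no records yet that a change of the list could destroy. -/
theorem SearchStep.length_add_card_records {v₀ : Fin n} {s s' : SearchState d × ScanState d}
    {a b : ℕ} (hs : SearchStep σ f s s' a b) (h : SearchInvariant σ f v₀ s.1 s.2) :
    s.1.visited.length + (records σ f s.1.visited s.2.count).card + b ≤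
      s'.1.visited.length + (records σ f s'.1.visited s'.2.count).card := by
  have hmono : ∀ S k, (records σ f S k).card ≤ (records σ f S (k + 1)).card := fun S k => by
    refine Finset.card_le_card fun q hq => ?_
    simp only [records, Finset.mem_filter, Finset.mem_univ, true_and] at hq ⊢
    exact ⟨by omega, hq.2⟩
  cases hs with
  | done | known | pop => simp
  | skip => simp [hmono]
  | improve c S P k b hk hu =>
    have hσk : σ (σ.symm ⟨k, hk⟩) = ⟨k, hk⟩ := σ.apply_symm_apply _
    generalize σ.symm ⟨k, hk⟩ = q₀ at *
    simp only [ScanState.IsUseless, Classical.not_imp, not_exists, not_and, not_le] at hu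
    have hq₀ : q₀ ∉ records σ f S k := by simp [records, hσk]
    rw [add_assoc, ← Finset.card_insert_of_notMem hq₀]
    refine Nat.add_le_add_left (Finset.card_le_card (Finset.insert_subset ?_ fun q hq => ?_)) _
    · simp only [records, Finset.mem_filter, Finset.mem_univ, true_and, hσk, Nat.lt_succ_self]
      refine ⟨hu.1, fun q' hq' hlt => ?_⟩
      rw [hσk] at hlt
      obtain ⟨p, hp, hle⟩ := h.best_le q' (by rw [hq']; exact hu.1) hlt
      rw [hq'] at hp
      exact (hu.2 p hp).trans_le hle
    · simp only [records, Finset.mem_filter, Finset.mem_univ, true_and] at hq ⊢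
      exact ⟨by omega, hq.2⟩
  | push u T c S P R hc hmem =>
    have hR : R.count = 0 := h.count_eq (List.cons_ne_nil u T)
    simp [records, hR]

/-- Each scanned entry of the search pays for its own step and for one later pop, hence the factor
`2`; the `1` pays for popping the root. So `3m + 2` steps suffice. -/
theorem SearchStep.progress {v₀ : Fin n} {s s' : SearchState d × ScanState d} {a b : ℕ}
    (hs : SearchStep σ f s s' a b) (h : SearchInvariant σ f v₀ s.1 s.2) {t : ℕ}
    (ht : (s.1.stack = [] ∧ s.2.count = ∑ i, d i) ∨
      t + s.1.stack.length ≤ 2 * ∑ i, s.1.scanned i + s.2.count + 1) :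
    (s'.1.stack = [] ∧ s'.2.count = ∑ i, d i) ∨
      t + 1 + s'.1.stack.length ≤ 2 * ∑ i, s'.1.scanned i + s'.2.count + 1 := by
  cases hs with
  | done c S P k b hk => exact Or.inl ⟨rfl, le_antisymm h.count_le hk⟩
  | skip c S P k b hk =>
    refine Or.inr ?_
    rcases ht with ⟨-, ht⟩ | ht
    · exact absurd ht hk.ne
    · simp only [List.length_nil] at ht ⊢
      omega
  | improve c S P k b hk =>
    refine Or.inr ?_
    rcases ht with ⟨-, ht⟩ | ht
    · exact absurd ht hk.ne
    · simp only [List.length_nil] at ht ⊢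
      omega
  | known | push | pop =>
    refine Or.inr ?_
    rcases ht with ⟨ht, -⟩ | ht
    · exact absurd ht (List.cons_ne_nil _ _)
    · simp only [List.length_cons, Finset.sum_update_succ] at ht ⊢
      omega

variable (σ f) (v₀ : Fin n)

theorem searchInvariant_run (t : ℕ) :
    SearchInvariant σ f v₀ ((searchMachine σ v₀).run f.entry t).1
      ((searchMachine σ v₀).run f.entry t).2 := by
  induction t with
  | zero => exact searchInvariant_init σ f v₀
  | succ t ih => exact ih.step (searchStep_next σ f v₀ _)

theorem searchMachine_run_fst (t : ℕ) : ((searchMachine σ v₀).run f.entry t).1 =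
    (SearchState.advance f)^[t] (SearchState.init d v₀) := by
  induction t with
  | zero => rfl
  | succ t ih =>
    rw [Function.iterate_succ_apply', ← ih]
    exact (searchStep_next σ f v₀ _).fst_eq

theorem searchMachine_finished :
    ((searchMachine σ v₀).run f.entry (3 * ∑ i, d i + 2)).1.stack = [] ∧
      ((searchMachine σ v₀).run f.entry (3 * ∑ i, d i + 2)).2.count = ∑ i, d i := by
  have key : ∀ t, (((searchMachine σ v₀).run f.entry t).1.stack = [] ∧
      ((searchMachine σ v₀).run f.entry t).2.count = ∑ i, d i) ∨
      t + ((searchMachine σ v₀).run f.entry t).1.stack.length ≤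
        2 * ∑ i, ((searchMachine σ v₀).run f.entry t).1.scanned i +
          ((searchMachine σ v₀).run f.entry t).2.count + 1 := fun t => by
    induction t with
    | zero => exact Or.inr (by simp [GuessingMachine.run, searchMachine, SearchState.init])
    | succ t ih => exact (searchStep_next σ f v₀ _).progress (searchInvariant_run σ f v₀ t) ih
  refine (key _).resolve_right fun h => ?_
  have hI := searchInvariant_run σ f v₀ (3 * ∑ i, d i + 2)
  have h1 := Finset.sum_le_sum fun i (_ : i ∈ Finset.univ) => hI.scanned_le i
  have h2 := hI.count_le
  omega

theorem queryCount_searchMachine_le (t : ℕ) :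
    (searchMachine σ v₀).queryCount f.entry t ≤ 2 * ∑ i, d i := by
  have key : (searchMachine σ v₀).queryCount f.entry t =
      ∑ i, ((searchMachine σ v₀).run f.entry t).1.scanned i +
        ((searchMachine σ v₀).run f.entry t).2.count := by
    induction t with
    | zero => simp [GuessingMachine.queryCount, GuessingMachine.run, searchMachine, SearchState.init]
    | succ t ih =>
      rw [GuessingMachine.queryCount, Finset.sum_range_succ]
      change GuessingMachine.queryCount _ _ _ + _ = _
      rw [ih]
      exact (searchStep_next σ f v₀ _).sum_scanned_add_count
  have hI := searchInvariant_run σ f v₀ t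
  have h1 := Finset.sum_le_sum fun i (_ : i ∈ Finset.univ) => hI.scanned_le i
  have h2 := hI.count_le
  omega

/-- The vertices in the order in which the depth-first search discovers them. -/
def discoveryOrder : List (Fin n) :=
  ((SearchState.advance f)^[3 * ∑ i, d i + 2] (SearchState.init d v₀)).visited

theorem surpriseCount_searchMachine_le :
    (searchMachine σ v₀).surpriseCount f.entry (3 * ∑ i, d i + 2) ≤
      n + (records σ f (discoveryOrder f v₀) (∑ i, d i)).card := by
  have key : ∀ t, (searchMachine σ v₀).surpriseCount f.entry t ≤
      ((searchMachine σ v₀).run f.entry t).1.visited.length +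
        (records σ f ((searchMachine σ v₀).run f.entry t).1.visited
          ((searchMachine σ v₀).run f.entry t).2.count).card := fun t => by
    induction t with
    | zero => simp [GuessingMachine.surpriseCount]
    | succ t ih =>
      rw [GuessingMachine.surpriseCount, Finset.sum_range_succ]
      change GuessingMachine.surpriseCount _ _ _ + _ ≤ _
      exact (Nat.add_le_add_right ih _).trans ((searchStep_next σ f v₀ _).length_add_card_records
        (searchInvariant_run σ f v₀ t))
  refine (key _).trans ?_
  rw [(searchMachine_finished σ f v₀).2, searchMachine_run_fst]
  refine Nat.add_le_add_right ?_ _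
  have hI := dfsInvariant_of_reflTransGen (searchInvariant_run σ f v₀ (3 * ∑ i, d i + 2)).dfs
  have := hI.nodup.length_le_card
  rwa [searchMachine_run_fst, Fintype.card_fin] at this

theorem mem_discoveryOrder_of_mem {u : Fin n} (hu : u ∈ discoveryOrder f v₀) (j : Fin (d u)) :
    f u j ∈ discoveryOrder f v₀ := by
  -- Any order will do, since the search ignores it.
  obtain ⟨σ⟩ : Nonempty (Position d ≃ Fin (∑ i, d i)) :=
    ⟨Fintype.equivFinOfCardEq (by simp [Fintype.card_sigma])⟩
  have hI := dfsInvariant_of_reflTransGen (searchInvariant_run σ f v₀ (3 * ∑ i, d i + 2)).dfs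
  have hst := (searchMachine_finished σ f v₀).1
  simp only [searchMachine_run_fst] at hI hst
  rw [hst] at hI
  exact hI.closed u hu List.not_mem_nil _ ⟨j, rfl⟩

/-- A record at `⟨u, j⟩` comes first in `σ` among the positions of `u` whose entries are discovered
no later. Its probability is at most the inverse of its rank, and the ranks at `u` contribute a
harmonic sum. -/
theorem sum_card_records_le (hf : f.IsSimple) :
    (∑ σ, ((records σ f (discoveryOrder f v₀) (∑ i, d i)).card : ℝ)) ≤
      Fintype.card (Position d ≃ Fin (∑ i, d i)) * (n * (1 + Real.log n)) := by
  classical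
  set S := discoveryOrder f v₀ with hS
  set N := Fintype.card (Position d ≃ Fin (∑ i, d i))
  let F : Position d → Finset (Position d ≃ Fin (∑ i, d i)) := fun q =>
    Finset.univ.filter fun σ => IsRecord σ f S q
  have h1 : ∑ σ, ((records σ f S (∑ i, d i)).card : ℝ) = ∑ q, ((F q).card : ℝ) := by
    simp only [records, F, Finset.card_filter, Fin.is_lt, true_and]
    push_cast
    exact Finset.sum_comm
  have h2 : ∀ u (j : Fin (d u)), ((F ⟨u, j⟩).card : ℝ) ≤ if u ∈ S then
      N * ((Finset.univ.filter fun j' => S.idxOf (f u j') ≤ S.idxOf (f u j)).card : ℝ)⁻¹ else 0 := by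
    intro u j
    split_ifs with hu
    · let L : Finset (Position d) := (Finset.univ.filter fun j' : Fin (d u) =>
        S.idxOf (f u j') ≤ S.idxOf (f u j)).image (Sigma.mk u)
      have hL : L.card = (Finset.univ.filter fun j' : Fin (d u) =>
          S.idxOf (f u j') ≤ S.idxOf (f u j)).card :=
        Finset.card_image_of_injective _ sigma_mk_injective
      have hmem : (⟨u, j⟩ : Position d) ∈ L := Finset.mem_image_of_mem _ (by simp)
      have h3 := card_mul_card_first_le (m := ∑ i, d i) L hmem
      rw [← hL, ← div_eq_mul_inv, le_div_iff₀' (by exact_mod_cast Finset.card_pos.2 ⟨_, hmem⟩)]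
      refine le_trans ?_ (Nat.cast_le.2 h3)
      push_cast
      refine mul_le_mul_of_nonneg_left (Nat.cast_le.2 (Finset.card_le_card fun σ hσ => ?_))
        (Nat.cast_nonneg _)
      simp only [F, Finset.mem_filter, Finset.mem_univ, true_and] at hσ ⊢
      rintro q' hq'
      obtain ⟨j', hj', rfl⟩ := Finset.mem_image.1 hq'
      by_contra hlt
      exact absurd (hσ.2 ⟨u, j'⟩ rfl (not_le.1 hlt)) (not_lt.2 (Finset.mem_filter.1 hj').2)
    · have : F ⟨u, j⟩ = ∅ := Finset.filter_eq_empty_iff.2 fun σ _ h => hu h.1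
      simp [this]
  have h3 : ∀ u, ∑ j, ((F ⟨u, j⟩).card : ℝ) ≤ N * (1 + Real.log n) := fun u => by
    have hn : 0 < n := u.pos
    have hlog : 0 ≤ Real.log n := Real.log_natCast_nonneg n
    by_cases hu : u ∈ S
    · have hkey : Function.Injective fun j => S.idxOf (f u j) := fun j j' h =>
        hf u ((List.idxOf_inj (mem_discoveryOrder_of_mem f v₀ hu j)).1 h)
      have hd : d u ≤ n := by
        simpa using Fintype.card_le_of_injective _ (hf u)
      calc ∑ j, ((F ⟨u, j⟩).card : ℝ) ≤ ∑ j, N *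
            ((Finset.univ.filter fun j' => S.idxOf (f u j') ≤ S.idxOf (f u j)).card : ℝ)⁻¹ :=
            Finset.sum_le_sum fun j _ => (h2 u j).trans_eq (if_pos hu)
        _ ≤ N * (harmonic (d u) : ℝ) := by
            rw [← Finset.mul_sum]
            exact mul_le_mul_of_nonneg_left (sum_inv_rank_le_harmonic _ hkey) (Nat.cast_nonneg _)
        _ ≤ N * (1 + Real.log n) := by
            refine mul_le_mul_of_nonneg_left ?_ (Nat.cast_nonneg _)
            rcases Nat.eq_zero_or_pos (d u) with h0 | h0
            · rw [h0]; simp; linarith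
            · refine (harmonic_le_one_add_log _).trans (add_le_add_right ?_ _)
              exact Real.log_le_log (by exact_mod_cast h0) (by exact_mod_cast hd)
    · refine (Finset.sum_nonpos fun j _ => (h2 u j).trans_eq (if_neg hu)).trans (by positivity)
  rw [h1, Fintype.sum_sigma]
  calc ∑ u, ∑ j, ((F ⟨u, j⟩).card : ℝ) ≤ ∑ _u : Fin n, N * (1 + Real.log n) :=
        Finset.sum_le_sum fun u _ => h3 u
    _ = _ := by
        rw [Finset.sum_const, Finset.card_univ, Fintype.card_fin, nsmul_eq_mul]
        ring

end

section

variable {n : ℕ} {d : Fin n → ℕ}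

/-- With `g` bounding the expected number of surprises, the cost is at most `4am + 2g/a`. The choice
`a = √(g/m)` gives `6√(gm)`, which is `12√(nm log n)`. -/
theorem average_cost_le (v₀ : Fin n) (hn : 2 ≤ n) (hm : 0 < ∑ i, d i) :
    ∃ a : ℝ, 0 < a ∧ a ≤ 1 ∧ ∀ f : ArrayGraph n d, f.IsSimple →
      (Fintype.card (Position d ≃ Fin (∑ i, d i)) : ℝ)⁻¹ *
        ∑ σ, ∑ t ∈ Finset.range (3 * ∑ i, d i + 2),
          (searchMachine σ v₀).cost a f.entry ((searchMachine σ v₀).run f.entry t) ≤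
      12 * √((n : ℝ) * ((∑ i, d i : ℕ) : ℝ) * Real.log n) := by
  set m := ∑ i, d i with hmdef
  set ι := Position d ≃ Fin m
  have : Nonempty ι := ⟨Fintype.equivFinOfCardEq (by simp [Fintype.card_sigma, hmdef])⟩
  have hN : (0 : ℝ) < Fintype.card ι := by exact_mod_cast Fintype.card_pos
  have hn' : (2 : ℝ) ≤ n := by exact_mod_cast hn
  have hm' : (0 : ℝ) < m := by exact_mod_cast hm
  have hlog : 2 / 3 ≤ Real.log n := by
    have h1 := Real.log_two_gt_d9
    have h2 := Real.log_le_log (by norm_num) hn'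
    linarith
  -- The expected number of surprises is at most `n(2 + log n)`, and `2 ≤ 3 log n`.
  set g : ℝ := 4 * (n * Real.log n) with hg
  have hg0 : 0 < g := by positivity
  have hgm : √(g * m) = 2 * √((n : ℝ) * m * Real.log n) := by
    rw [show g * m = 2 ^ 2 * ((n : ℝ) * m * Real.log n) by rw [hg]; ring,
      Real.sqrt_mul (by positivity), Real.sqrt_sq (by norm_num)]
  have hcount : ∀ (f : ArrayGraph n d) (σ : ι),
      ((searchMachine σ v₀).queryCount f.entry (3 * m + 2) : ℝ) ≤ 2 * m := fun f σ => by
    exact_mod_cast queryCount_searchMachine_le σ f v₀ _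
  rcases le_total g m with hle | hle
  · set a := √(g / m) with ha
    have ha0 : 0 < a := Real.sqrt_pos.2 (by positivity)
    have ha2 : a * a = g / m := Real.mul_self_sqrt (by positivity)
    have ham : a * m = √(g * m) := by
      rw [eq_comm, Real.sqrt_eq_iff_mul_self_eq_of_pos (by positivity), mul_mul_mul_comm, ha2]
      field_simp
    have hag : a⁻¹ * g = √(g * m) := by
      rw [← ham, inv_mul_eq_iff_eq_mul₀ ha0.ne', ← mul_assoc, ha2]
      field_simp
    refine ⟨a, ha0, Real.sqrt_le_one.2 ((div_le_one hm').2 hle), fun f hf => ?_⟩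
    rw [inv_mul_le_iff₀ hN]
    have hσ : ∀ σ : ι, ∑ t ∈ Finset.range (3 * m + 2),
        (searchMachine σ v₀).cost a f.entry ((searchMachine σ v₀).run f.entry t) ≤
        2 * a * (2 * m) + 2 * a⁻¹ * (n + (records σ f (discoveryOrder f v₀) m).card) := fun σ => by
      refine ((searchMachine σ v₀).sum_cost_le ha0 f.entry _).trans ?_
      have h1 := hcount f σ
      have h2 : ((searchMachine σ v₀).surpriseCount f.entry (3 * m + 2) : ℝ) ≤
          n + (records σ f (discoveryOrder f v₀) m).card := by
        exact_mod_cast surpriseCount_searchMachine_le σ f v₀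
      gcongr
    refine (Finset.sum_le_sum fun σ _ => hσ σ).trans ?_
    change _ ≤ Fintype.card ι * (12 * √((n : ℝ) * (m : ℝ) * Real.log n))
    rw [Finset.sum_add_distrib, Finset.sum_const, ← Finset.mul_sum, Finset.sum_add_distrib,
      Finset.sum_const, Finset.card_univ, nsmul_eq_mul, nsmul_eq_mul]
    have hrec := sum_card_records_le f v₀ hf
    have hsum : (Fintype.card ι : ℝ) * n +
        ∑ σ : ι, ((records σ f (discoveryOrder f v₀) m).card : ℝ) ≤ Fintype.card ι * g := by
      refine (add_le_add_right hrec _).trans ?_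
      rw [← mul_add]
      refine mul_le_mul_of_nonneg_left ?_ hN.le
      rw [hg]
      nlinarith
    have h2a : 0 ≤ 2 * a⁻¹ := by positivity
    refine (add_le_add_right (mul_le_mul_of_nonneg_left hsum h2a) _).trans (le_of_eq ?_)
    rw [show 2 * a⁻¹ * (Fintype.card ι * g) = 2 * Fintype.card ι * (a⁻¹ * g) by ring, hag,
      show (Fintype.card ι : ℝ) * (2 * a * (2 * m)) = 4 * Fintype.card ι * (a * m) by ring, ham,
      hgm]
    ring
  -- Here `g ≥ m` would push the weight above `1`; with weight `1` every query costs at most `2`,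
  -- and `4m ≤ 4√(gm)`.
  · refine ⟨1, one_pos, le_rfl, fun f hf => ?_⟩
    rw [inv_mul_le_iff₀ hN]
    have hσ : ∀ σ : ι, ∑ t ∈ Finset.range (3 * m + 2),
        (searchMachine σ v₀).cost 1 f.entry ((searchMachine σ v₀).run f.entry t) ≤ 4 * m :=
      fun σ => ((searchMachine σ v₀).sum_cost_one_le f.entry _).trans (by linarith [hcount f σ])
    refine (Finset.sum_le_sum fun σ _ => hσ σ).trans ?_
    rw [Finset.sum_const, Finset.card_univ, nsmul_eq_mul]
    refine mul_le_mul_of_nonneg_left ?_ hN.le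
    have h1 : (m : ℝ) ≤ √(g * m) := Real.le_sqrt_of_sq_le (by nlinarith)
    rw [hgm] at h1
    linarith [Real.sqrt_nonneg ((n : ℝ) * m * Real.log n)]

/-! ### The query bound and the certificate -/

theorem one_le_sqrt_mul_log (hn : 2 ≤ n) {m : ℕ} (hm : 0 < m) :
    1 ≤ √((n : ℝ) * (m : ℝ) * Real.log n) := by
  have hn' : (2 : ℝ) ≤ n := by exact_mod_cast hn
  have hm' : (1 : ℝ) ≤ m := by exact_mod_cast hm
  have h1 := Real.log_two_gt_d9
  have h2 := Real.log_le_log (by norm_num) hn'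
  have h3 : (2 : ℝ) * 1 ≤ n * m := by gcongr
  exact Real.one_le_sqrt.2 (by nlinarith)

theorem exists_search_algorithm [NeZero n] (v₀ : Fin n) (hn : 2 ≤ n) (hm : 0 < ∑ i, d i) :
    ∃ M : ArrayAlgorithm n d (Finset (Position d) × Finset (Position d)),
      (M.queries : ℝ) ≤ 433 * √((n : ℝ) * ((∑ i, d i : ℕ) : ℝ) * Real.log n) ∧
      ∀ f : ArrayGraph n d, f.IsSimple → 2 / 3 ≤ M.prob f.entry fun o =>
        IsDfsWithSmallestNeighbours f.Edge v₀ (f.edges o.1) (f.edges o.2) ∧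
          (o.1 ∪ o.2).card ≤ 2 * n := by
  classical
  obtain ⟨a, ha, ha1, hcost⟩ := average_cost_le v₀ hn hm
  have : Nonempty (Position d ≃ Fin (∑ i, d i)) :=
    ⟨Fintype.equivFinOfCardEq (by simp [Fintype.card_sigma])⟩
  have hr := one_le_sqrt_mul_log hn hm
  set r := √((n : ℝ) * ((∑ i, d i : ℕ) : ℝ) * Real.log n)
  obtain ⟨M, hM, hP⟩ := GuessingMachine.exists_algorithm
    (fun σ : Position d ≃ Fin (∑ i, d i) => searchMachine σ v₀) (3 * ∑ i, d i + 2) ha ha1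
    -- `432 = 36 · 12`; rounding up costs at most one more `r`, since `r ≥ 1`.
    (K := ⌈432 * r⌉₊) (Nat.ceil_pos.2 (by linarith))
    (fun _ s => ((s.1.tree, s.2.bestPositions) : Finset (Position d) × Finset (Position d)))
  refine ⟨M, ?_, fun f hf => hP f.entry _ (fun σ => ?_) ?_⟩
  · rw [hM]
    have := Nat.ceil_lt_add_one (show 0 ≤ 432 * r by linarith)
    linarith
  · have hI := searchInvariant_run σ f v₀ (3 * ∑ i, d i + 2)
    obtain ⟨h1, h2⟩ := searchMachine_finished σ f v₀
    refine ⟨hI.isDfsWithSmallestNeighbours h1 h2, ?_⟩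
    have h3 := (dfsInvariant_of_reflTransGen hI.dfs).nodup.length_le_card
    rw [Fintype.card_fin] at h3
    have h4 := hI.card_tree.le.trans h3
    have h5 := ((searchMachine σ v₀).run f.entry (3 * ∑ i, d i + 2)).2.card_bestPositions_le
    refine (Finset.card_union_le _ _).trans ?_
    exact (Nat.add_le_add h4 h5).trans_eq (two_mul n).symm
  · have := hcost f hf
    have h1 := Nat.le_ceil (432 * r)
    linarith

/-- `A` is a tree rooted at `v₀`, `B` has at most one edge out of each vertex, and some edge leads
out of `v₀` if its out-degree is positive. -/
def IsCovering (d : Fin n → ℕ) (v₀ : Fin n) (A B : Finset (Fin n × Fin n)) : Prop :=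
  IsTreeRootedAt v₀ A ∧ (∀ e ∈ B, ∀ e' ∈ B, e.1 = e'.1 → e = e') ∧
    (0 < d v₀ → ∃ w, (v₀, w) ∈ A ∪ B)

theorem isTreeRootedAt_empty {V : Type} (r : V) : IsTreeRootedAt r (∅ : Finset (V × V)) := by
  simp [IsTreeRootedAt]

theorem ArrayGraph.edge_of_mem_edges {f : ArrayGraph n d} {P : Finset (Position d)}
    {e : Fin n × Fin n} (he : e ∈ f.edges P) : f.Edge e.1 e.2 := by
  obtain ⟨q, -, rfl⟩ := Finset.mem_image.1 he
  exact ⟨q.2, rfl⟩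

theorem ArrayGraph.edges_congr {f g : ArrayGraph n d} {P : Finset (Position d)}
    (h : ∀ q ∈ P, f.entry q = g.entry q) : f.edges P = g.edges P :=
  Finset.image_congr fun q hq => by rw [h q hq]

/-- The position of the first out-neighbour of `v`. -/
def firstPosition (d : Fin n → ℕ) (v : Fin n) : Finset (Position d) :=
  if h : 0 < d v then {⟨v, 0, h⟩} else ∅

theorem isCovering_firstPosition (f : ArrayGraph n d) (v₀ : Fin n) :
    IsCovering d v₀ ∅ (f.edges (firstPosition d v₀)) := by
  refine ⟨isTreeRootedAt_empty v₀, ?_, fun h => ⟨f v₀ ⟨0, h⟩, ?_⟩⟩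
  · unfold firstPosition
    split_ifs <;> simp [ArrayGraph.edges]
  · simp [firstPosition, h, ArrayGraph.edges, ArrayGraph.entry]

theorem IsDfsWithSmallestNeighbours.isCovering {f : ArrayGraph n d} {v₀ : Fin n}
    {A B : Finset (Fin n × Fin n)} (h : IsDfsWithSmallestNeighbours f.Edge v₀ A B) :
    IsCovering d v₀ A B := by
  obtain ⟨S, hS, hB⟩ := h
  have hI := dfsInvariant_of_reflTransGen hS
  refine ⟨hS.isTreeRootedAt, ?_, fun hd => ?_⟩
  · rintro ⟨u, w⟩ he ⟨u', w'⟩ he' rfl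
    obtain ⟨hu, hw, hmin⟩ := (hB u w).1 he
    obtain ⟨-, hw', hmin'⟩ := (hB u w').1 he'
    have hwS : w ∈ S := hI.closed u hu List.not_mem_nil w hw
    rw [(List.idxOf_inj hwS).1 (le_antisymm (hmin w' hw') (hmin' w hw))]
  · obtain ⟨w, hw, -⟩ := hB.exists_mem hI.root_mem (y := f v₀ ⟨0, hd⟩) ⟨_, rfl⟩
    exact ⟨w, Finset.mem_union_right _ hw⟩

/-- Supplies the constant output when the input is unique and no query is allowed. -/
theorem exists_isDfsWithSmallestNeighbours (f : ArrayGraph n d) (v₀ : Fin n) :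
    ∃ P P', IsDfsWithSmallestNeighbours f.Edge v₀ (f.edges P) (f.edges P') := by
  obtain ⟨σ⟩ : Nonempty (Position d ≃ Fin (∑ i, d i)) :=
    ⟨Fintype.equivFinOfCardEq (by simp [Fintype.card_sigma])⟩
  obtain ⟨h1, h2⟩ := searchMachine_finished σ f v₀
  exact ⟨_, _, (searchInvariant_run σ f v₀ _).isDfsWithSmallestNeighbours h1 h2⟩

theorem ArrayGraph.edge_of_mem_union {f : ArrayGraph n d} {P P' : Finset (Position d)} :
    ∀ e ∈ f.edges P ∪ f.edges P', f.Edge e.1 e.2 := fun _ he =>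
  (Finset.mem_union.1 he).elim edge_of_mem_edges edge_of_mem_edges

theorem verification_count_le (hn : 2 ≤ n) {m : ℕ} (hm : 0 < m) :
    ((min (2 * n + 1) m : ℕ) : ℝ) ≤ 3 * √((n : ℝ) * (m : ℝ) * Real.log n) := by
  have hn' : (2 : ℝ) ≤ n := by exact_mod_cast hn
  have hm' : (1 : ℝ) ≤ m := by exact_mod_cast hm
  have h1 := Real.log_two_gt_d9
  have h2 := Real.log_le_log (by norm_num) hn'
  have h3 : ((min (2 * n + 1) m : ℕ) : ℝ) ≤ 2 * n + 1 := by
    exact_mod_cast min_le_left _ _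
  have h4 : ((min (2 * n + 1) m : ℕ) : ℝ) ≤ m := by exact_mod_cast min_le_right _ _
  rw [← div_le_iff₀' (by norm_num)]
  refine Real.le_sqrt_of_sq_le ?_
  have h5 : ((min (2 * n + 1) m : ℕ) : ℝ) * ((min (2 * n + 1) m : ℕ) : ℝ) ≤ (2 * n + 1) * m :=
    mul_le_mul h3 h4 (Nat.cast_nonneg _) (by positivity)
  have h6 : (n : ℝ) * m * (2 / 3) ≤ n * m * Real.log n := by
    refine mul_le_mul_of_nonneg_left (by linarith) (by positivity)
  rw [div_pow, div_le_iff₀ (by norm_num), sq]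
  nlinarith

/-- The edges are read off at the claimed positions, so they belong to the graph. Whether they form
a tree and a covering is then checked without further queries; the at most `2n + 1` verification
queries raise the constant from `433` to `436`. -/
theorem exists_certified_algorithm [NeZero n] (d : Fin n → ℕ) (v₀ : Fin n) :
    ∃ M : ArrayAlgorithm n d (Finset (Fin n × Fin n) × Finset (Fin n × Fin n)),
      (M.queries : ℝ) ≤ 436 * √((n : ℝ) * ((∑ i, d i : ℕ) : ℝ) * Real.log n) ∧
      ∀ f : ArrayGraph n d, f.IsSimple →
        M.prob f.entry (fun o => (∀ e ∈ o.1 ∪ o.2, f.Edge e.1 e.2) ∧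
          IsCovering d v₀ o.1 o.2) = 1 ∧
        2 / 3 ≤ M.prob f.entry fun o => (∀ e ∈ o.1 ∪ o.2, f.Edge e.1 e.2) ∧
          IsDfsWithSmallestNeighbours f.Edge v₀ o.1 o.2 := by
  classical
  by_cases hcase : 2 ≤ n ∧ 0 < ∑ i, d i
  · obtain ⟨hn, hm⟩ := hcase
    obtain ⟨M, hM, hMf⟩ := exists_search_algorithm v₀ hn hm
    -- The fallback position is always queried, and claims of more than `2n` positions are rejected
    -- unread to bound the number of queries.
    let S : Finset (Position d) × Finset (Position d) → Finset (Position d) := fun o =>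
      if (o.1 ∪ o.2).card ≤ 2 * n then o.1 ∪ o.2 ∪ firstPosition d v₀ else firstPosition d v₀
    let graph : (Position d → Fin n) → ArrayGraph n d := fun x i j => x ⟨i, j⟩
    let g : Finset (Position d) × Finset (Position d) → (Position d → Fin n) →
        Finset (Fin n × Fin n) × Finset (Fin n × Fin n) := fun o x =>
      if (o.1 ∪ o.2).card ≤ 2 * n ∧
          IsCovering d v₀ ((graph x).edges o.1) ((graph x).edges o.2) then
        ((graph x).edges o.1, (graph x).edges o.2)
      else (∅, (graph x).edges (firstPosition d v₀))
    have hfirst : (firstPosition d v₀).card ≤ 1 := by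
      unfold firstPosition
      split_ifs <;> simp
    have hcard : ∀ o, (S o).card ≤ min (2 * n + 1) (∑ i, d i) := fun o => by
      refine le_min ?_ ((Finset.card_le_univ _).trans_eq (by simp [Fintype.card_sigma]))
      simp only [S]
      split_ifs with h
      · exact (Finset.card_union_le _ _).trans (add_le_add h hfirst)
      · omega
    have hcert : ∀ o (f : ArrayGraph n d),
        (∀ e ∈ (g o f.entry).1 ∪ (g o f.entry).2, f.Edge e.1 e.2) ∧
          IsCovering d v₀ (g o f.entry).1 (g o f.entry).2 := fun o f => by
      simp only [g]
      split_ifs with h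
      · exact ⟨ArrayGraph.edge_of_mem_union, h.2⟩
      · exact ⟨fun e he => ArrayGraph.edge_of_mem_edges (f := f)
          (by rw [Finset.empty_union] at he; exact he),
          isCovering_firstPosition f v₀⟩
    have hg : ∀ o x y, (∀ q ∈ S o, x q = y q) → g o x = g o y := fun o x y h => by
      by_cases hc : (o.1 ∪ o.2).card ≤ 2 * n
      · have hS : S o = o.1 ∪ o.2 ∪ firstPosition d v₀ := if_pos hc
        have hP : ∀ P ⊆ S o, (graph x).edges P = (graph y).edges P := fun P hP =>
          ArrayGraph.edges_congr fun q hq => h q (hP hq)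
        rw [hS] at hP
        simp only [g]
        rw [hP o.1 (Finset.subset_union_left.trans Finset.subset_union_left),
          hP o.2 (Finset.subset_union_right.trans Finset.subset_union_left),
          hP _ Finset.subset_union_right]
      · have hS : S o = firstPosition d v₀ := if_neg hc
        have hP : (graph x).edges (firstPosition d v₀) = (graph y).edges (firstPosition d v₀) :=
          ArrayGraph.edges_congr fun q hq => h q (hS ▸ hq)
        simp only [g, hc, false_and, if_false, hP]
    obtain ⟨M', hM', hprob⟩ := M.exists_postprocessing S _ hcard g hg
    refine ⟨M', ?_, fun f hf => ⟨?_, ?_⟩⟩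
    · rw [hM']
      have := verification_count_le hn hm
      rw [Nat.cast_add]
      linarith
    · rw [hprob]
      exact M.prob_eq_one _ fun o => hcert o f
    · rw [hprob]
      refine (hMf f hf).trans (M.prob_mono _ fun o ho => ⟨(hcert o f).1, ?_⟩)
      have : g o f.entry = (f.edges o.1, f.edges o.2) := if_pos ⟨ho.2, ho.1.isCovering⟩
      rw [this]
      exact ho.1
  -- For `n = 1` or `m = 0` the bound is zero, but there is at most one input.
  · have hsub : Subsingleton (ArrayGraph n d) := by
      by_cases hn : 2 ≤ n
      · have hd : ∑ i, d i = 0 := by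
          by_contra h
          exact hcase ⟨hn, Nat.pos_of_ne_zero h⟩
        have hd' : ∀ i, d i = 0 := fun i => Finset.sum_eq_zero_iff.1 hd i (Finset.mem_univ i)
        exact ⟨fun f g => funext fun i => funext fun j => absurd j.2 (by simp [hd' i])⟩
      · have : n = 1 := by have := NeZero.pos n; omega
        subst this
        infer_instance
    have hsqrt := Real.sqrt_nonneg ((n : ℝ) * ((∑ i, d i : ℕ) : ℝ) * Real.log n)
    by_cases hf : Nonempty (ArrayGraph n d)
    · obtain ⟨f⟩ := hf
      obtain ⟨P, P', hP⟩ := exists_isDfsWithSmallestNeighbours f v₀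
      obtain ⟨M, hM, hprob⟩ := QuantumQueryAlgorithm.exists_constant (Q := Position d) (n := n)
        (f.edges P, f.edges P')
      refine ⟨M, by rw [hM, Nat.cast_zero]; positivity, fun f' _ => ?_⟩
      rw [Subsingleton.elim f' f, hprob _ _ ⟨ArrayGraph.edge_of_mem_union, hP.isCovering⟩,
        hprob _ _ ⟨ArrayGraph.edge_of_mem_union, hP⟩]
      norm_num
    · obtain ⟨M, hM, -⟩ := QuantumQueryAlgorithm.exists_constant (Q := Position d) (n := n)
        ((∅, ∅) : Finset (Fin n × Fin n) × Finset (Fin n × Fin n))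
      exact ⟨M, by rw [hM, Nat.cast_zero]; positivity, fun f => absurd ⟨f⟩ hf⟩

end

theorem mainTheorem9 :
    (∃ C : ℝ, 0 < C ∧ ∀ (n : ℕ) [NeZero n] (d : Fin n → ℕ) (v₀ : Fin n),
      ∃ M : ArrayAlgorithm n d (Finset (Fin n × Fin n) × Finset (Fin n × Fin n)),
        (M.queries : ℝ) ≤ C * Real.sqrt ((n : ℝ) * ((∑ i, d i : ℕ) : ℝ) * Real.log n) ∧
        ∀ f : ArrayGraph n d, f.IsSimple →
          -- with certainty, the output `E' = A ∪ B` consists of edges and covers `v₀`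
          M.prob f.entry (fun (A, B) =>
            (∀ e ∈ A ∪ B, f.Edge e.1 e.2) ∧
            IsTreeRootedAt v₀ A ∧
            (∀ e ∈ B, ∀ e' ∈ B, e.1 = e'.1 → e = e') ∧
            (0 < d v₀ → ∃ w, (v₀, w) ∈ A ∪ B)) = 1 ∧
          (1 / 4 : ℝ) ≤ M.prob f.entry (fun (A, B) => IsDfsWithSmallestNeighbours f.Edge v₀ A B) ∧
          (StronglyConnected f.Edge →
            (1 / 4 : ℝ) ≤ M.prob f.entry (fun (A, B) =>
              IsDfsWithSmallestNeighbours f.Edge v₀ A B ∧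
              StronglyConnected (edgeRel (A ∪ B))))) ∧
    (∃ C : ℝ, 0 < C ∧ ∀ (n : ℕ) [NeZero n] (d : Fin n → ℕ),
      ∃ M : ArrayAlgorithm n d Bool,
        (M.queries : ℝ) ≤ C * Real.sqrt ((n : ℝ) * ((∑ i, d i : ℕ) : ℝ) * Real.log n) ∧
        ∀ f : ArrayGraph n d, f.IsSimple →
          (StronglyConnected f.Edge → (2 / 3 : ℝ) ≤ M.prob f.entry (fun b => b = true)) ∧
          (¬ StronglyConnected f.Edge → (2 / 3 : ℝ) ≤ M.prob f.entry (fun b => b = false))) := by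
  classical
  refine ⟨⟨436, by norm_num, fun n _ d v₀ => ?_⟩, ⟨436, by norm_num, fun n _ d => ?_⟩⟩
  · obtain ⟨M, hM, hMf⟩ := exists_certified_algorithm d v₀
    refine ⟨M, hM, fun f hf => ?_⟩
    obtain ⟨h1, h2⟩ := hMf f hf
    refine ⟨h1, ?_, fun hE => ?_⟩
    · exact le_trans (by norm_num) (h2.trans (M.prob_mono _ fun o ho => ho.2))
    · exact le_trans (by norm_num)
        (h2.trans (M.prob_mono _ fun o ho => ⟨ho.2, ho.2.stronglyConnected hE⟩))
  · obtain ⟨M, hM, hMf⟩ := exists_certified_algorithm d 0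
    -- The output edges lie in the graph, so they can be strongly connected only if the graph is.
    refine ⟨M.mapOutput fun o => decide (StronglyConnected (edgeRel (o.1 ∪ o.2))), hM,
      fun f hf => ⟨fun hE => ?_, fun hE => ?_⟩⟩
    · rw [QuantumQueryAlgorithm.prob_mapOutput]
      exact (hMf f hf).2.trans (M.prob_mono _ fun o ho =>
        decide_eq_true (ho.2.stronglyConnected hE))
    · rw [QuantumQueryAlgorithm.prob_mapOutput]
      exact (hMf f hf).2.trans (M.prob_mono _ fun o ho =>
        decide_eq_false fun h => hE (h.mono fun u v huv => ho.1 (u, v) huv))
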